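/- Let $N$ be the number of frequency modes. A *50:50 beamsplitter* between two distinct modes is the fixed matrix $\frac1{\sqrt2}\begin{pmatrix}1&i\\ i&1\end{pmatrix}$ on these modes and the identity on the others. A *phase shifter* with phase $\varphi:\mathbb R\to\mathbb R$ multiplies one mode by $e^{i\varphi(\omega)}$. A *chain of cavities* multiplies one mode by a finite product of all-pass factors $\frac{\gamma_k+i(\omega+\Delta_k)}{\gamma_k-i(\omega+\Delta_k)}$ with $\gamma_k>0$, $\Delta_k\in\mathbb R$. A *mesh* is a finite sequence of beamsplitters and single-mode devices; its transfer matrix is the product of theirs. 1. Let $U:\mathbb R\to U(N)$ be any smooth (respectively real-analytic) unitary-matrix-valued function of $\omega$. Then there is a mesh of 50:50 beamsplitters and phase shifters with smooth (respectively real-analytic) phases whose transfer matrix is exactly $U(\omega)$ for all $\omega\in\mathbb R$. Each of its phase shifters is approximated by chains of cavities up to the response of a reference chain: for every band $[a,b]$ and $\varepsilon>0$ there are chains with responses $c(\omega)$, $d(\omega)$ such that $|c(\omega)-d(\omega)e^{i\varphi(\omega)}|<\varepsilon$ on $[a,b]$. Moreover, for every $[a,b]$ and $\varepsilon>0$ there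 are a mesh of 50:50 beamsplitters and chains of cavities, with transfer matrix $V(\omega)$, and a chain with response $d(\omega)$, common to all modes, such that every entry of $V(\omega)-d(\omega)U(\omega)$ has modulus less than $\varepsilon$ on $[a,b]$. 2. Let $U_{\mathrm{IME}}(\omega)$ be the transfer function of a passive linear system, $U_{\mathrm{IME}}(\omega)=\sqrt{2\Gamma}\,(\Gamma+iG-i\omega)^{-1}\sqrt{2\Gamma}-I$ with $G$ an $N\times N$ Hermitian matrix and $\Gamma$ a diagonal matrix with positive diagonal (the input-output relation of $\dot a=(-\Gamma-iG)a+\sqrt{2\Gamma}\,a_{\mathrm{in}}$, $a_{\mathrm{in}}+a_{\mathrm{out}}=\sqrt{2\Gamma}\,a$), or a finite product (cascade) of such functions. Then there is a mesh of 50:50 beamsplitters and phase shifters with real-analytic phases whose transfer matrix is exactly $U_{\mathrm{IME}}(\omega)$ for all $\omega\in\mathbb R$ and in which, for every $[a,b]$ and $\varepsilon>0$, each phase shifter can be replaced by a chain of cavities, on the same mode and with response within $\varepsilon$ of $e^{i\varphi(\omega)}$ on $[a,b]$, so that the resulting mesh of 50:50 beamsplitters and chains of cavities has a transfer matrix which differs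 from $U_{\mathrm{IME}}(\omega)$ by less than $\varepsilon$ in every entry on $[a,b]$. -/

import Mathlib

open scoped ContDiff

noncomputable section

namespace FrequencyMesh

/-- The fixed 50:50 beamsplitter between the modes `m` and `n`: the matrix
`(1/√2) * [[1, i], [i, 1]]` on these two modes and the identity on all the others. -/
def beamSplitter {N : ℕ} (m n : Fin N) : Matrix (Fin N) (Fin N) ℂ :=
  Matrix.of fun i j =>
    if (i = m ∧ j = m) ∨ (i = n ∧ j = n) then ((1 / Real.sqrt 2 : ℝ) : ℂ)
    else if (i = m ∧ j = n) ∨ (i = n ∧ j = m) then Complex.I * ((1 / Real.sqrt 2 : ℝ) : ℂ)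
    else if i = j then 1 else 0

/-- The transformation which multiplies mode `m` by `z` and leaves the other modes unchanged. -/
def onMode {N : ℕ} (m : Fin N) (z : ℂ) : Matrix (Fin N) (Fin N) ℂ :=
  Matrix.diagonal fun i => if i = m then z else 1

/-- One element of a mesh on `N` modes: a fixed 50:50 beamsplitter between two distinct modes, or
a single-mode device of type `P` placed on one mode. -/
inductive Element (N : ℕ) (P : Type) where
  | splitter (m n : Fin N) (hmn : m ≠ n) : Element N P
  | single (m : Fin N) (p : P) : Element N P

/-- The transfer matrix of an element at frequency `w`, when the single-mode device `p`
has the response `resp p w`. -/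
def Element.transfer {N : ℕ} {P : Type} (resp : P → ℝ → ℂ) (w : ℝ) :
    Element N P → Matrix (Fin N) (Fin N) ℂ
  | .splitter m n _ => beamSplitter m n
  | .single m p => onMode m (resp p w)

/-- A mesh is a finite sequence of elements. -/
abbrev Mesh (N : ℕ) (P : Type) : Type := List (Element N P)

/-- The transfer matrix of a mesh is the product of those of its elements. -/
def Mesh.transfer {N : ℕ} {P : Type} (resp : P → ℝ → ℂ) (M : Mesh N P) (w : ℝ) :
    Matrix (Fin N) (Fin N) ℂ :=
  (M.map (Element.transfer resp w)).prod

/-- Every single-mode device of the mesh has the property `Q`. -/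
def Mesh.AllSingle {N : ℕ} {P : Type} (Q : P → Prop) (M : Mesh N P) : Prop :=
  ∀ (m : Fin N) (p : P), Element.single m p ∈ M → Q p

/-- The response `exp (i φ(w))` of a frequency-dependent phase shifter with phase `φ`. -/
def shifterResponse (φ : ℝ → ℝ) (w : ℝ) : ℂ :=
  Complex.exp (Complex.I * (φ w : ℂ))

/-- A single-mode cavity, with damping `γ > 0` and detuning `Δ`. -/
structure Cavity where
  γ : ℝ
  γ_pos : 0 < γ
  Δ : ℝ

/-- The all-pass response `(γ + i(w + Δ)) / (γ - i(w + Δ))` of a single-mode cavity. -/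
def Cavity.response (c : Cavity) (w : ℝ) : ℂ :=
  ((c.γ : ℂ) + Complex.I * ((w : ℂ) + (c.Δ : ℂ))) /
    ((c.γ : ℂ) - Complex.I * ((w : ℂ) + (c.Δ : ℂ)))

/-- The response of a linear chain of single-mode cavities. -/
def chainResponse (C : List Cavity) (w : ℝ) : ℂ :=
  (C.map fun c => c.response w).prod

/-- The mesh element `e'` is `e`, with a phase shifter replaced by a cavity chain on the same mode
whose response is within `ε` of that of the phase shifter on the whole band `[a, b]`. -/
inductive Replaces {N : ℕ} (a b ε : ℝ) : Element N (ℝ → ℝ) → Element N (List Cavity) → Prop where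
  | splitter (m n : Fin N) (hmn : m ≠ n) :
      Replaces a b ε (Element.splitter m n hmn) (Element.splitter m n hmn)
  | single (m : Fin N) (φ : ℝ → ℝ) (C : List Cavity)
      (h : ∀ w ∈ Set.Icc a b, ‖chainResponse C w - shifterResponse φ w‖ < ε) :
      Replaces a b ε (Element.single m φ) (Element.single m C)

/-- A passive linear system of `N` coupled cavity modes, with the quantum Langevin equations
`da/dt = (-Γ - iG) a + √(2Γ) a_in`, `a_in + a_out = √(2Γ) a`: the Hamiltonian is
`∑ G m n a_m† a_n` with `G` Hermitian (no pair production terms), and `Γ` is the diagonal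
matrix of the positive damping rates. -/
structure PassiveSystem (N : ℕ) where
  G : Matrix (Fin N) (Fin N) ℂ
  G_herm : G.IsHermitian
  γ : Fin N → ℝ
  γ_pos : ∀ m, 0 < γ m

/-- The transfer function `√(2Γ) (Γ + iG - iw)⁻¹ √(2Γ) - 1` of a passive system, from `a_in` to
`a_out`, in the Fourier convention in which `d/dt` becomes `-iw` (for `N = 1` and `G = -Δ` it is
the response of a single-mode cavity). -/
def PassiveSystem.transfer {N : ℕ} (S : PassiveSystem N) (w : ℝ) : Matrix (Fin N) (Fin N) ℂ :=
  (Matrix.diagonal fun m => ((Real.sqrt (2 * S.γ m) : ℝ) : ℂ)) *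
    ((Matrix.diagonal fun m => (S.γ m : ℂ)) + Complex.I • S.G -
      (Complex.I * (w : ℂ)) • (1 : Matrix (Fin N) (Fin N) ℂ))⁻¹ *
    (Matrix.diagonal fun m => ((Real.sqrt (2 * S.γ m) : ℝ) : ℂ)) - 1

/-- The transfer function of a cascade of passive systems. -/
def cascadeTransfer {N : ℕ} (L : List (PassiveSystem N)) (w : ℝ) : Matrix (Fin N) (Fin N) ℂ :=
  (L.map fun S => S.transfer w).prod

end FrequencyMesh

end

/-!
Every column of a smooth unitary can be swept onto one mode by interferometers, and what remains
then acts on one mode fewer. An interferometer nulls one of two signals when its phases are the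
arguments and the arctangent of the ratio of their moduli. These depend smoothly on the frequency
only while the signals do not vanish, so the signals are first mixed in a ratio `t ∈ ℂ` which
creates no zeros except common ones: the bad ratios lie on smooth curves, of dimension at most one.
All modes together have no common zero, because a column of a unitary never vanishes.

Up to a reference chain, the phases approximated by chains form a closed group, which contains
`2 arctan (t w + δ)`. Differentiating in `δ` and in `t` yields the functions `1 / (1 + (t w)²)` and
`w / (1 + (t w)²)` and all their multiples; letting `t → 0` gives `1` and `w`, the division
`w² / (1 + (t w)²) = t⁻² (1 - 1 / (1 + (t w)²))` gives the higher powers, and Weierstrass' theorem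
every continuous phase.

A passive system is lossless. A unitary change of states makes its drift matrix triangular, which
factors the transfer function into systems with one state each, and such a system is a single
cavity between two constant unitaries. Its phases are already those of chains, so no reference is
needed.
-/

namespace FrequencyMesh

open Matrix

section Embed

variable {κ ι R : Type*}

open Classical in
/-- The modes `ι`, split into those in the range of `f`, labelled by `κ`, and all the others. -/
noncomputable def splitRange (f : κ ↪ ι) : κ ⊕ ↥(Set.range f)ᶜ ≃ ι :=
  ((Equiv.ofInjective f f.injective).sumCongr (Equiv.refl _)).trans (Equiv.Set.sumCompl _)

theorem splitRange_symm_apply (f : κ ↪ ι) (k : κ) : (splitRange f).symm (f k) = Sum.inl k :=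
  (Equiv.symm_apply_eq _).2 rfl

theorem splitRange_symm_apply_of_notMem (f : κ ↪ ι) {i : ι} (hi : i ∉ Set.range f) :
    (splitRange f).symm i = Sum.inr ⟨i, hi⟩ :=
  (Equiv.symm_apply_eq _).2 rfl

variable [Fintype κ] [DecidableEq κ] [Fintype ι] [DecidableEq ι]

open Classical in
/-- The transformation of the modes `ι` which acts on the modes `f k` as `A` acts on the modes `k`,
and leaves the modes outside the range of `f` unchanged. -/
noncomputable def embed [Semiring R] (f : κ ↪ ι) : Matrix κ κ R →* Matrix ι ι R where
  toFun A := (fromBlocks A 0 0 1).submatrix (splitRange f).symm (splitRange f).symm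
  map_one' := by simp
  map_mul' A B := by simp [submatrix_mul_equiv, fromBlocks_multiply]

variable [Semiring R] (f : κ ↪ ι) (A : Matrix κ κ R)

theorem embed_apply_apply (k l : κ) : embed f A (f k) (f l) = A k l := by
  simp [embed, splitRange_symm_apply]

theorem embed_apply_of_notMem_left {i : ι} (hi : i ∉ Set.range f) (j : ι) :
    embed f A i j = (1 : Matrix ι ι R) i j := by
  by_cases hj : j ∈ Set.range f
  · obtain ⟨l, rfl⟩ := hj
    have hne : i ≠ f l := fun h => hi ⟨l, h.symm⟩
    simp [embed, splitRange_symm_apply, splitRange_symm_apply_of_notMem f hi, one_apply_ne hne]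
  · simp [embed, splitRange_symm_apply_of_notMem f hi, splitRange_symm_apply_of_notMem f hj,
      one_apply]

theorem embed_apply_of_notMem_right (i : ι) {j : ι} (hj : j ∉ Set.range f) :
    embed f A i j = (1 : Matrix ι ι R) i j := by
  by_cases hi : i ∈ Set.range f
  · obtain ⟨k, rfl⟩ := hi
    have hne : f k ≠ j := fun h => hj ⟨k, h⟩
    simp [embed, splitRange_symm_apply, splitRange_symm_apply_of_notMem f hj, one_apply_ne hne]
  · exact embed_apply_of_notMem_left f A hi j

theorem embed_injective : Function.Injective (embed f : Matrix κ κ R → Matrix ι ι R) :=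
  fun A B h => Matrix.ext fun k l => by rw [← embed_apply_apply f A, h, embed_apply_apply]

variable {f A} in
theorem eq_embed {B : Matrix ι ι R} (hB : ∀ k l, B (f k) (f l) = A k l)
    (hl : ∀ i ∉ Set.range f, ∀ j, B i j = (1 : Matrix ι ι R) i j)
    (hr : ∀ i, ∀ j ∉ Set.range f, B i j = (1 : Matrix ι ι R) i j) : B = embed f A := by
  ext i j
  by_cases hi : i ∈ Set.range f
  · by_cases hj : j ∈ Set.range f
    · obtain ⟨k, rfl⟩ := hi
      obtain ⟨l, rfl⟩ := hj
      rw [hB, embed_apply_apply]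
    · rw [hr i j hj, embed_apply_of_notMem_right f A i hj]
  · rw [hl i hi j, embed_apply_of_notMem_left f A hi j]

open Classical in
theorem embed_mulVec_apply (v : ι → R) (k : κ) :
    (embed f A *ᵥ v) (f k) = (A *ᵥ (v ∘ f)) k := by
  simp only [embed, MonoidHom.coe_mk, OneHom.coe_mk, submatrix_mulVec_equiv, fromBlocks_mulVec,
    Function.comp_apply, splitRange_symm_apply, Sum.elim_inl, zero_mulVec, add_zero]
  rfl

open Classical in
theorem embed_mulVec_apply_of_notMem (v : ι → R) {i : ι} (hi : i ∉ Set.range f) :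
    (embed f A *ᵥ v) i = v i := by
  simp only [embed, MonoidHom.coe_mk, OneHom.coe_mk, submatrix_mulVec_equiv, fromBlocks_mulVec,
    Function.comp_apply, splitRange_symm_apply_of_notMem f hi, Sum.elim_inr, zero_mulVec, zero_add,
    one_mulVec]
  rfl

theorem embed_conjTranspose [StarRing R] : embed f Aᴴ = (embed f A)ᴴ := by
  simp [embed, fromBlocks_conjTranspose]

theorem embed_mem_unitaryGroup_iff {R : Type*} [CommRing R] [StarRing R] (f : κ ↪ ι)
    {A : Matrix κ κ R} : embed f A ∈ unitaryGroup ι R ↔ A ∈ unitaryGroup κ R := by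
  rw [mem_unitaryGroup_iff, mem_unitaryGroup_iff, star_eq_conjTranspose, star_eq_conjTranspose,
    ← embed_conjTranspose, ← map_mul, ← map_one (embed f), (embed_injective f).eq_iff]

end Embed

section Devices

variable {k N : ℕ}

theorem onMode_mul (m : Fin N) (y z : ℂ) : onMode m (y * z) = onMode m y * onMode m z := by
  rw [onMode, onMode, onMode, diagonal_mul_diagonal]
  congr with i
  split_ifs <;> simp

theorem onMode_one (m : Fin N) : onMode m 1 = 1 := by
  simp [onMode]

theorem onMode_mulVec (m : Fin N) (z : ℂ) (v : Fin N → ℂ) :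
    onMode m z *ᵥ v = Function.update v m (z * v m) := by
  ext i
  rw [onMode, mulVec_diagonal]
  rcases eq_or_ne i m with rfl | hi
  · simp
  · simp [hi]

theorem conjTranspose_onMode (m : Fin N) (z : ℂ) : (onMode m z)ᴴ = onMode m (star z) := by
  rw [onMode, onMode, diagonal_conjTranspose]
  congr with i
  by_cases hi : i = m <;> simp [hi]

theorem onMode_mem_unitaryGroup (m : Fin N) {z : ℂ} (hz : z ∈ unitary ℂ) :
    onMode m z ∈ unitaryGroup (Fin N) ℂ := by
  rw [mem_unitaryGroup_iff, star_eq_conjTranspose, conjTranspose_onMode, ← onMode_mul,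
    Unitary.mul_star_self_of_mem hz, onMode_one]

theorem embed_onMode (f : Fin k ↪ Fin N) (m : Fin k) (z : ℂ) :
    embed f (onMode m z) = onMode (f m) z := by
  have hne {i : Fin N} (hi : i ∉ Set.range f) (l : Fin k) : i ≠ f l := fun h => hi ⟨l, h.symm⟩
  refine (eq_embed (fun l l' => ?_) (fun i hi j => ?_) fun i j hj => ?_).symm
  · simp [onMode, diagonal_apply]
  · simp [onMode, diagonal_apply, one_apply, hne hi]
  · rcases eq_or_ne i j with rfl | hij
    · simp [onMode, hne hj]
    · simp [onMode, hij]

theorem embed_beamSplitter (f : Fin k ↪ Fin N) (m n : Fin k) :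
    embed f (beamSplitter m n) = beamSplitter (f m) (f n) := by
  have hne {i : Fin N} (hi : i ∉ Set.range f) (l : Fin k) : i ≠ f l := fun h => hi ⟨l, h.symm⟩
  refine (eq_embed (fun l l' => ?_) (fun i hi j => ?_) fun i j hj => ?_).symm
  · simp [beamSplitter]
  · simp [beamSplitter, one_apply, hne hi]
  · simp [beamSplitter, one_apply, hne hj]

/-- The modes `m` and `n`, as a two-mode subsystem. -/
def pair {m n : Fin N} (hmn : m ≠ n) : Fin 2 ↪ Fin N :=
  ⟨![m, n], by simpa [Function.Injective, Fin.forall_fin_two] using ⟨hmn, hmn.symm⟩⟩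

theorem pair_zero {m n : Fin N} (hmn : m ≠ n) : pair hmn 0 = m := rfl

theorem pair_one {m n : Fin N} (hmn : m ≠ n) : pair hmn 1 = n := rfl

theorem beamSplitter_zero_one :
    beamSplitter (0 : Fin 2) 1 =
      ((1 / √2 : ℝ) : ℂ) • !![1, Complex.I; Complex.I, 1] := by
  ext i j
  fin_cases i <;> fin_cases j <;> simp [beamSplitter, mul_comm]

theorem conjTranspose_beamSplitter {m n : Fin N} (hmn : m ≠ n) :
    (beamSplitter m n)ᴴ = onMode n (-1) * beamSplitter m n * onMode n (-1) := by
  have h : (beamSplitter (0 : Fin 2) 1)ᴴ =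
      onMode 1 (-1) * beamSplitter 0 1 * onMode 1 (-1) := by
    rw [beamSplitter_zero_one]
    ext i j
    fin_cases i <;> fin_cases j <;> simp [onMode]
  simpa [embed_conjTranspose, embed_beamSplitter, embed_onMode, pair_zero, pair_one] using
    congrArg (embed (pair hmn)) h

theorem beamSplitter_mem_unitaryGroup {m n : Fin N} (hmn : m ≠ n) :
    beamSplitter m n ∈ unitaryGroup (Fin N) ℂ := by
  have h : beamSplitter (0 : Fin 2) 1 * (beamSplitter 0 1)ᴴ = 1 := by
    have hs : ((1 / √2 : ℝ) : ℂ) * star ((1 / √2 : ℝ) : ℂ) = 1 / 2 := by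
      rw [Complex.star_def, Complex.conj_ofReal, ← Complex.ofReal_mul, div_mul_div_comm,
        Real.mul_self_sqrt zero_le_two]
      simp
    rw [beamSplitter_zero_one, conjTranspose_smul, smul_mul_smul_comm, hs]
    ext i j
    fin_cases i <;> fin_cases j <;> norm_num [vecMul, dotProduct, Fin.sum_univ_two]
  rw [mem_unitaryGroup_iff, star_eq_conjTranspose]
  simpa [embed_conjTranspose, embed_beamSplitter, pair_zero, pair_one] using
    congrArg (embed (pair hmn)) h

theorem Element.transfer_mem_unitaryGroup {P : Type} {resp : P → ℝ → ℂ} {w : ℝ}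
    (h : ∀ p, resp p w ∈ unitary ℂ) :
    ∀ e : Element N P, e.transfer resp w ∈ unitaryGroup (Fin N) ℂ
  | .splitter _ _ hmn => beamSplitter_mem_unitaryGroup hmn
  | .single m p => onMode_mem_unitaryGroup m (h p)

theorem Mesh.transfer_mem_unitaryGroup {P : Type} {resp : P → ℝ → ℂ} {w : ℝ}
    (h : ∀ p, resp p w ∈ unitary ℂ) (M : Mesh N P) :
    M.transfer resp w ∈ unitaryGroup (Fin N) ℂ :=
  Submonoid.list_prod_mem _ <| by
    simpa using fun e _ => Element.transfer_mem_unitaryGroup h e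

theorem Mesh.transfer_cons {P : Type} (resp : P → ℝ → ℂ) (e : Element N P) (M : Mesh N P) (w : ℝ) :
    Mesh.transfer resp (e :: M) w = e.transfer resp w * M.transfer resp w :=
  List.prod_cons

theorem Mesh.transfer_append {P : Type} (resp : P → ℝ → ℂ) (M M' : Mesh N P) (w : ℝ) :
    Mesh.transfer resp (M ++ M') w = M.transfer resp w * M'.transfer resp w := by
  simp [Mesh.transfer]

end Devices

section Shifter

theorem shifterResponse_zero (w : ℝ) : shifterResponse 0 w = 1 := by
  simp [shifterResponse]

theorem shifterResponse_add (φ ψ : ℝ → ℝ) (w : ℝ) :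
    shifterResponse (φ + ψ) w = shifterResponse φ w * shifterResponse ψ w := by
  simp [shifterResponse, mul_add, Complex.exp_add]

theorem star_shifterResponse (φ : ℝ → ℝ) (w : ℝ) :
    star (shifterResponse φ w) = shifterResponse (-φ) w := by
  simp [shifterResponse, ← Complex.exp_conj]

theorem shifterResponse_mem_unitary (φ : ℝ → ℝ) (w : ℝ) : shifterResponse φ w ∈ unitary ℂ := by
  rw [Unitary.mem_iff_self_mul_star, star_shifterResponse, ← shifterResponse_add, add_neg_cancel,
    shifterResponse_zero]

theorem contDiff_shifterResponse {r : WithTop ℕ∞} {φ : ℝ → ℝ} (hφ : ContDiff ℝ r φ) :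
    ContDiff ℝ r (shifterResponse φ) :=
  (contDiff_const.mul (Complex.ofRealCLM.contDiff.comp hφ)).cexp

end Shifter

section Realizable

variable {k N : ℕ} {Q Q' : Set (ℝ → ℝ)} {r : WithTop ℕ∞}

/-- The frequency-dependent transformations of `N` modes which are the transfer matrices of meshes
of 50:50 beamsplitters and phase shifters with phases in `Q`. -/
def realizable (N : ℕ) (Q : Set (ℝ → ℝ)) : Submonoid (ℝ → Matrix (Fin N) (Fin N) ℂ) where
  carrier := {U | ∃ M : Mesh N (ℝ → ℝ),
    M.AllSingle (· ∈ Q) ∧ ∀ w, M.transfer shifterResponse w = U w}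
  one_mem' := ⟨[], by simp [Mesh.AllSingle], fun _ => rfl⟩
  mul_mem' := by
    rintro U V ⟨M, hM, hU⟩ ⟨M', hM', hV⟩
    refine ⟨M ++ M', fun m φ h => ?_, fun w => ?_⟩
    · exact (List.mem_append.1 h).elim (hM m φ) (hM' m φ)
    · rw [Mesh.transfer_append, hU, hV, Pi.mul_apply]

theorem beamSplitter_mem_realizable {m n : Fin N} (hmn : m ≠ n) :
    (fun _ => beamSplitter m n) ∈ realizable N Q :=
  ⟨[.splitter m n hmn], by simp [Mesh.AllSingle],
    fun _ => by simp [Mesh.transfer, Element.transfer]⟩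

theorem onMode_mem_realizable (m : Fin N) {φ : ℝ → ℝ} (hφ : φ ∈ Q) :
    (fun w => onMode m (shifterResponse φ w)) ∈ realizable N Q :=
  ⟨[.single m φ], by simpa [Mesh.AllSingle] using hφ,
    fun _ => by simp [Mesh.transfer, Element.transfer]⟩

theorem realizable_le {S : Submonoid (ℝ → Matrix (Fin N) (Fin N) ℂ)}
    (splitter : ∀ m n : Fin N, m ≠ n → (fun _ => beamSplitter m n) ∈ S)
    (single : ∀ m : Fin N, ∀ φ ∈ Q, (fun w => onMode m (shifterResponse φ w)) ∈ S) :
    realizable N Q ≤ S := by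
  rintro U ⟨M, hM, hU⟩
  obtain rfl : M.transfer shifterResponse = U := funext hU
  clear hU
  induction M with
  | nil => exact S.one_mem
  | cons e M ih =>
    have hmul : Mesh.transfer shifterResponse (e :: M) =
        (fun w => e.transfer shifterResponse w) * Mesh.transfer shifterResponse M :=
      funext (Mesh.transfer_cons _ e M)
    rw [hmul]
    refine S.mul_mem ?_ (ih fun m φ h => hM m φ (List.mem_cons_of_mem e h))
    cases e with
    | splitter m n hmn => exact splitter m n hmn
    | single m φ => exact single m φ (hM m φ List.mem_cons_self)

theorem mem_unitaryGroup_of_mem_realizable {U : ℝ → Matrix (Fin N) (Fin N) ℂ}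
    (hU : U ∈ realizable N Q) (w : ℝ) : U w ∈ unitaryGroup (Fin N) ℂ := by
  obtain ⟨M, -, hM⟩ := hU
  exact hM w ▸ M.transfer_mem_unitaryGroup fun φ => shifterResponse_mem_unitary φ w

theorem embed_mem_realizable (f : Fin k ↪ Fin N) {U : ℝ → Matrix (Fin k) (Fin k) ℂ}
    (hU : U ∈ realizable k Q) : (fun w => embed f (U w)) ∈ realizable N Q := by
  refine realizable_le (S := (realizable N Q).comap ((embed f).compLeft ℝ)) (fun m n hmn => ?_)
    (fun m φ hφ => ?_) hU
  · have h := beamSplitter_mem_realizable (Q := Q) (f.injective.ne hmn)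
    rwa [← embed_beamSplitter] at h
  · have h := onMode_mem_realizable (f m) hφ
    simp only [← embed_onMode] at h
    exact h

theorem contDiff_mul {l m n : Type*} [Fintype m] {A : ℝ → Matrix l m ℂ} {B : ℝ → Matrix m n ℂ}
    (hA : ∀ i j, ContDiff ℝ r fun w => A w i j) (hB : ∀ i j, ContDiff ℝ r fun w => B w i j)
    (i : l) (j : n) : ContDiff ℝ r fun w => (A w * B w) i j := by
  simp only [mul_apply]
  exact ContDiff.sum fun k _ => (hA i k).mul (hB k j)

theorem contDiff_of_mem_realizable {U : ℝ → Matrix (Fin N) (Fin N) ℂ}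
    (hU : U ∈ realizable N {φ | ContDiff ℝ r φ}) (i j : Fin N) :
    ContDiff ℝ r fun w => U w i j := by
  let S : Submonoid (ℝ → Matrix (Fin N) (Fin N) ℂ) :=
    { carrier := {U | ∀ i j, ContDiff ℝ r fun w => U w i j}
      one_mem' := fun _ _ => contDiff_const
      mul_mem' := contDiff_mul }
  refine realizable_le (S := S) (fun m n _ _ _ => contDiff_const) (fun m φ hφ i j => ?_) hU i j
  simp only [onMode, diagonal_apply]
  split_ifs
  exacts [contDiff_shifterResponse hφ, contDiff_const, contDiff_const]

theorem star_mem_realizable {U : ℝ → Matrix (Fin N) (Fin N) ℂ}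
    (hU : U ∈ realizable N {φ | ContDiff ℝ r φ}) : star U ∈ realizable N {φ | ContDiff ℝ r φ} := by
  let S : Submonoid (ℝ → Matrix (Fin N) (Fin N) ℂ) :=
    { carrier := {U | star U ∈ realizable N {φ | ContDiff ℝ r φ}}
      one_mem' := by simp
      mul_mem' := fun hU hV => by simpa using mul_mem hV hU }
  refine realizable_le (S := S) (fun m n hmn => ?_) (fun m φ hφ => ?_) hU
  · have hpi : (fun _ => onMode n (-1)) ∈ realizable N {φ | ContDiff ℝ r φ} := by
      simpa [shifterResponse, mul_comm Complex.I, Complex.exp_pi_mul_I] using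
        onMode_mem_realizable n (φ := fun _ => Real.pi) (Q := {φ | ContDiff ℝ r φ}) contDiff_const
    have hstar : star (fun _ : ℝ => beamSplitter m n) = (fun _ => onMode n (-1)) *
        (fun _ => beamSplitter m n) * fun _ => onMode n (-1) :=
      funext fun _ => conjTranspose_beamSplitter hmn
    change star _ ∈ realizable N _
    rw [hstar]
    exact mul_mem (mul_mem hpi (beamSplitter_mem_realizable hmn)) hpi
  · have hstar : star (fun w => onMode m (shifterResponse φ w)) =
        fun w => onMode m (shifterResponse (-φ) w) := by
      funext w
      rw [Pi.star_apply, star_eq_conjTranspose, conjTranspose_onMode, star_shifterResponse]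
    change star _ ∈ realizable N _
    rw [hstar]
    exact onMode_mem_realizable m (ContDiff.neg hφ)

theorem const_mem_realizable {U : ℝ → Matrix (Fin N) (Fin N) ℂ} (w₀ : ℝ)
    (hQ : ∀ φ ∈ Q, (fun _ => φ w₀) ∈ Q') (hU : U ∈ realizable N Q) :
    (fun _ => U w₀) ∈ realizable N Q' := by
  let F : (ℝ → Matrix (Fin N) (Fin N) ℂ) →* (ℝ → Matrix (Fin N) (Fin N) ℂ) :=
    (Pi.constMonoidHom ℝ _).comp (Pi.evalMonoidHom _ w₀)
  exact realizable_le (S := (realizable N Q').comap F) (fun _ _ => beamSplitter_mem_realizable)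
    (fun m φ hφ => onMode_mem_realizable m (hQ φ hφ)) hU

end Realizable

section Phase

variable {r : WithTop ℕ∞}

theorem exists_continuous_cexp_eq {X : Type*} [TopologicalSpace X] [SimplyConnectedSpace X]
    [LocallyPathConnectedSpace X] {u : X → ℂ} (hu : Continuous u) (h0 : ∀ x, u x ≠ 0) :
    ∃ F : X → ℂ, Continuous F ∧ ∀ x, Complex.exp (F x) = u x := by
  obtain ⟨x₀⟩ : Nonempty X := inferInstance
  obtain ⟨F, ⟨-, hF⟩, -⟩ := Complex.isCoveringMapOn_exp.existsUnique_continuousMap_lifts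
    ⟨u, hu⟩ (Complex.exp_log (h0 x₀)) h0
  exact ⟨F, F.continuous, congrFun hF⟩

theorem contDiff_of_cexp {E : Type*} [NormedAddCommGroup E] [NormedSpace ℝ E] {F : E → ℂ}
    (hF : Continuous F) (h : ContDiff ℝ r fun x => Complex.exp (F x)) : ContDiff ℝ r F := by
  refine contDiff_iff_contDiffAt.2 fun x₀ => ?_
  have hlog : ContDiffAt ℝ r
      (fun x => F x₀ + Complex.log (Complex.exp (F x) / Complex.exp (F x₀))) x₀ := by
    have hone : Complex.exp (F x₀) / Complex.exp (F x₀) ∈ Complex.slitPlane := by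
      rw [div_self (Complex.exp_ne_zero _)]
      exact Complex.one_mem_slitPlane
    exact contDiffAt_const.add <| ContDiffAt.comp x₀ (g := Complex.log)
      ((Complex.contDiffAt_log hone).restrict_scalars ℝ) (h.contDiffAt.div_const _)
  have him : ∀ᶠ x in nhds x₀, (F x - F x₀).im ∈ Set.Ioo (-Real.pi) Real.pi := by
    have hcont : Continuous fun x => (F x - F x₀).im := by fun_prop
    exact hcont.continuousAt.preimage_mem_nhds (Ioo_mem_nhds (by simp [Real.pi_pos])
      (by simp [Real.pi_pos]))
  refine hlog.congr_of_eventuallyEq ?_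
  filter_upwards [him] with x hx
  rw [← Complex.exp_sub, Complex.log_exp hx.1 hx.2.le, add_sub_cancel]

theorem exists_contDiff_phase {u : ℝ → ℂ} (hu : ContDiff ℝ r u) (h0 : ∀ w, u w ≠ 0) :
    ∃ φ : ℝ → ℝ, ContDiff ℝ r φ ∧ ∀ w, shifterResponse φ w * u w = ‖u w‖ := by
  obtain ⟨F, hF, hFu⟩ := exists_continuous_cexp_eq hu.continuous h0
  refine ⟨fun w => -(F w).im, ?_, fun w => ?_⟩
  · exact (Complex.imCLM.contDiff.comp (contDiff_of_cexp hF (by simpa only [hFu] using hu))).neg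
  · rw [← hFu, shifterResponse, ← Complex.exp_add, Complex.norm_exp, Complex.ofReal_exp]
    congr 1
    apply Complex.ext <;> simp

end Phase

section Generic

theorem dimH_image_le_finrank {E F : Type*} [NormedAddCommGroup E] [NormedSpace ℝ E]
    [FiniteDimensional ℝ E] [NormedAddCommGroup F] [NormedSpace ℝ F] {f : E → F} {s : Set E}
    (hf : ∀ x ∈ s, ContDiffAt ℝ 1 f x) : dimH (f '' s) ≤ Module.finrank ℝ E :=
  calc dimH (f '' s) ≤ dimH s := dimH_image_le_of_locally_lipschitzOn fun x hx => by
        obtain ⟨K, t, ht, hK⟩ := (hf x hx).exists_lipschitzOnWith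
        exact ⟨K, t, mem_nhdsWithin_of_mem_nhds ht, hK⟩
    _ ≤ dimH (Set.univ : Set E) := dimH_mono s.subset_univ
    _ = Module.finrank ℝ E := Real.dimH_univ_eq_finrank E

theorem exists_ne_zero_mixture_ne_zero {f g : ℝ → ℂ} (hf : ContDiff ℝ 1 f) (hg : ContDiff ℝ 1 g) :
    ∃ t : ℂ, t ≠ 0 ∧ ∀ w, f w + t * g w = 0 ∨ star t * f w - g w = 0 → f w = 0 ∧ g w = 0 := by
  let A : Set ℂ := (fun w => -f w * (g w)⁻¹) '' {w | g w ≠ 0}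
  let B : Set ℂ := (fun w => Complex.conjCLE (g w * (f w)⁻¹)) '' {w | f w ≠ 0}
  have hA : dimH A ≤ 1 :=
    (dimH_image_le_finrank fun w (hw : g w ≠ 0) =>
      hf.neg.contDiffAt.mul (hg.contDiffAt.inv hw)).trans_eq (by simp)
  have hB : dimH B ≤ 1 :=
    (dimH_image_le_finrank fun w (hw : f w ≠ 0) =>
      Complex.conjCLE.contDiff.contDiffAt.comp w
        (hg.contDiffAt.mul (hf.contDiffAt.inv hw))).trans_eq (by simp)
  have hdense : Dense (A ∪ B ∪ {0})ᶜ := by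
    apply dense_compl_of_dimH_lt_finrank
    rw [dimH_union, dimH_union, dimH_singleton, Complex.finrank_real_complex]
    exact (max_le (max_le hA hB) zero_le_one).trans_lt (by norm_num)
  obtain ⟨t, ht⟩ := hdense.nonempty
  obtain ⟨ht0, htA, htB⟩ : t ≠ 0 ∧ t ∉ A ∧ t ∉ B := by simpa [not_or] using ht
  refine ⟨t, ht0, fun w h => ?_⟩
  rcases h with h | h
  · have hgw : g w = 0 := by
      by_contra hgw
      refine htA ⟨w, hgw, ?_⟩
      field_simp
      linear_combination -h
    exact ⟨by simpa [hgw] using h, hgw⟩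
  · have hfw : f w = 0 := by
      by_contra hfw
      refine htB ⟨w, hfw, ?_⟩
      have hdiv : g w * (f w)⁻¹ = star t := by
        field_simp
        linear_combination -h
      simp [hdiv]
    exact ⟨hfw, by simpa [hfw] using h⟩

end Generic

section Interferometer

variable {r : WithTop ℕ∞}

theorem beamSplitter_mul_onMode_mul_beamSplitter (z : ℂ) :
    beamSplitter (0 : Fin 2) 1 * onMode 0 z * beamSplitter 0 1 =
      (1 / 2 : ℂ) • !![z - 1, Complex.I * (z + 1); Complex.I * (z + 1), 1 - z] := by
  have hs : ((1 / √2 : ℝ) : ℂ) * ((1 / √2 : ℝ) : ℂ) = 1 / 2 := by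
    rw [← Complex.ofReal_mul, div_mul_div_comm, Real.mul_self_sqrt zero_le_two]
    norm_num
  have hd : onMode (0 : Fin 2) z = !![z, 0; 0, 1] := by
    ext i j
    fin_cases i <;> fin_cases j <;> simp [onMode]
  rw [beamSplitter_zero_one, hd, smul_mul_assoc, smul_mul_smul_comm, hs]
  ext i j
  fin_cases i <;> fin_cases j <;> simp <;> grind [Complex.I_mul_I]

/-- The real reflection of two modes which a Mach–Zehnder interferometer performs, up to a common
phase, when the phase difference of its arms is `2 * θ`. -/
noncomputable def reflection (θ : ℝ) : Matrix (Fin 2) (Fin 2) ℂ :=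
  !![(Real.sin θ : ℂ), Real.cos θ; Real.cos θ, -Real.sin θ]

theorem reflection_eq_smul (θ : ℝ) :
    reflection θ = Complex.exp (-(Real.pi / 2 + θ) * Complex.I) •
      (beamSplitter 0 1 * onMode 0 (Complex.exp (2 * θ * Complex.I)) * beamSplitter 0 1) := by
  have hz : Complex.exp (2 * θ * Complex.I) = Complex.exp (θ * Complex.I) ^ 2 := by
    rw [← Complex.exp_nat_mul]
    ring_nf
  have hy : Complex.exp (-(Real.pi / 2 + θ) * Complex.I) =
      -Complex.I * Complex.exp (-θ * Complex.I) := by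
    rw [← Complex.exp_neg_pi_div_two_mul_I, ← Complex.exp_add]
    ring_nf
  have hyz : Complex.exp (-θ * Complex.I) * Complex.exp (θ * Complex.I) = 1 := by
    rw [← Complex.exp_add, neg_mul, neg_add_cancel, Complex.exp_zero]
  have hsin : (Real.sin θ : ℂ) = -Complex.I * Complex.exp (-θ * Complex.I) *
      (1 / 2 * (Complex.exp (θ * Complex.I) ^ 2 - 1)) := by
    rw [Complex.ofReal_sin, Complex.sin]
    linear_combination Complex.I * Complex.exp (θ * Complex.I) / 2 * hyz
  have hcos : (Real.cos θ : ℂ) = -Complex.I * Complex.exp (-θ * Complex.I) *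
      (1 / 2 * (Complex.I * (Complex.exp (θ * Complex.I) ^ 2 + 1))) := by
    rw [Complex.ofReal_cos, Complex.cos]
    linear_combination (Complex.exp (-θ * Complex.I) * (1 + Complex.exp (θ * Complex.I) ^ 2)) / 2 *
      Complex.I_mul_I - Complex.exp (θ * Complex.I) / 2 * hyz
  rw [beamSplitter_mul_onMode_mul_beamSplitter, reflection, hsin, hcos, hz, hy]
  ext i j
  fin_cases i <;> fin_cases j <;> simp; ring

theorem onMode_zero_mul_onMode_one (z : ℂ) :
    onMode (0 : Fin 2) z * onMode 1 z = z • (1 : Matrix (Fin 2) (Fin 2) ℂ) := by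
  ext i j
  fin_cases i <;> fin_cases j <;> simp [onMode]

theorem reflection_mem_realizable {θ : ℝ → ℝ} (hθ : ContDiff ℝ r θ) :
    (fun w => reflection (θ w)) ∈ realizable 2 {φ | ContDiff ℝ r φ} := by
  have hα : ContDiff ℝ r fun w => -(Real.pi / 2 + θ w) := (contDiff_const.add hθ).neg
  have hβ : ContDiff ℝ r fun w => 2 * θ w := contDiff_const.mul hθ
  have hB : (fun _ => beamSplitter 0 1) ∈ realizable 2 {φ | ContDiff ℝ r φ} :=
    beamSplitter_mem_realizable zero_ne_one
  have h := mul_mem (mul_mem (onMode_mem_realizable 0 hα) (onMode_mem_realizable 1 hα))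
    (mul_mem (mul_mem hB (onMode_mem_realizable 0 hβ)) hB)
  convert h using 1
  funext w
  simp only [Pi.mul_apply, onMode_zero_mul_onMode_one, smul_mul, one_mul, reflection_eq_smul,
    shifterResponse, mul_comm Complex.I]
  push_cast
  rfl

end Interferometer

section Elimination

variable {N : ℕ} {r : WithTop ℕ∞} {c c' c'' : ℝ → Fin N → ℂ} {m n : Fin N}

/-- The signals `c'` on `N` modes which a mesh with `C^r` phases makes out of the signals `c`. -/
def Reach (r : WithTop ℕ∞) (c c' : ℝ → Fin N → ℂ) : Prop :=
  ∃ T ∈ realizable N {φ | ContDiff ℝ r φ}, ∀ w, c' w = T w *ᵥ c w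

theorem Reach.refl : Reach r c c :=
  ⟨1, one_mem _, fun w => (one_mulVec (c w)).symm⟩

theorem Reach.trans (h : Reach r c c') (h' : Reach r c' c'') : Reach r c c'' := by
  obtain ⟨T, hT, hc⟩ := h
  obtain ⟨T', hT', hc'⟩ := h'
  exact ⟨T' * T, mul_mem hT' hT, fun w => by rw [hc', hc, mulVec_mulVec, Pi.mul_apply]⟩

theorem Reach.contDiff (h : Reach r c c') (hc : ∀ i, ContDiff ℝ r fun w => c w i) (i : Fin N) :
    ContDiff ℝ r fun w => c' w i := by
  obtain ⟨T, hT, hc'⟩ := h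
  simp only [hc', mulVec, dotProduct]
  exact ContDiff.sum fun j _ => (contDiff_of_mem_realizable hT i j).mul (hc j)

theorem reach_shift (m : Fin N) {φ : ℝ → ℝ} (hφ : ContDiff ℝ r φ) :
    Reach r c fun w => Function.update (c w) m (shifterResponse φ w * c w m) :=
  ⟨_, onMode_mem_realizable m hφ, fun w => (onMode_mulVec m _ (c w)).symm⟩

theorem exists_reach_reflect (hmn : m ≠ n) {θ : ℝ → ℝ} (hθ : ContDiff ℝ r θ) :
    ∃ c', Reach r c c' ∧
      (∀ w, c' w m = Real.sin (θ w) * c w m + Real.cos (θ w) * c w n) ∧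
      (∀ w, c' w n = Real.cos (θ w) * c w m - Real.sin (θ w) * c w n) ∧
      ∀ w i, i ≠ m → i ≠ n → c' w i = c w i := by
  refine ⟨_, ⟨_, embed_mem_realizable (pair hmn) (reflection_mem_realizable hθ), fun w => rfl⟩,
    fun w => ?_, fun w => ?_, fun w i hm hn => embed_mulVec_apply_of_notMem _ _ _ ?_⟩
  · refine (embed_mulVec_apply (pair hmn) _ _ 0).trans ?_
    simp [mulVec, dotProduct, reflection, pair_zero, pair_one]
  · refine (embed_mulVec_apply (pair hmn) _ _ 1).trans ?_
    simp [mulVec, dotProduct, reflection, pair_zero, pair_one, sub_eq_add_neg]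
  · rintro ⟨k, rfl⟩
    fin_cases k
    exacts [hm rfl, hn rfl]

theorem exists_reach_interfere (hmn : m ≠ n) {φ ψ θ : ℝ → ℝ} (hφ : ContDiff ℝ r φ)
    (hψ : ContDiff ℝ r ψ) (hθ : ContDiff ℝ r θ) :
    ∃ c', Reach r c c' ∧
      (∀ w, c' w m = Real.sin (θ w) * (shifterResponse φ w * c w m) +
        Real.cos (θ w) * (shifterResponse ψ w * c w n)) ∧
      (∀ w, c' w n = Real.cos (θ w) * (shifterResponse φ w * c w m) -
        Real.sin (θ w) * (shifterResponse ψ w * c w n)) ∧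
      ∀ w i, i ≠ m → i ≠ n → c' w i = c w i := by
  obtain ⟨c', hc', hm, hn, hi⟩ := exists_reach_reflect hmn hθ
  refine ⟨c', ((reach_shift m hφ).trans (reach_shift n hψ)).trans hc', fun w => ?_, fun w => ?_,
    fun w i him hin => ?_⟩
  · simp [hm, hmn, hmn.symm]
  · simp [hn, hmn, hmn.symm]
  · simp [hi w i him hin, him, hin]

theorem sin_arctan_div_mul {a b : ℝ} (hb : b ≠ 0) :
    Real.sin (Real.arctan (a / b)) * b = Real.cos (Real.arctan (a / b)) * a := by
  rw [← Real.tan_mul_cos (Real.cos_arctan_pos _).ne', Real.tan_arctan]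
  field_simp

theorem exists_reach_mix (hr : 1 ≤ r) (hc : ∀ i, ContDiff ℝ r fun w => c w i) (hmn : m ≠ n) :
    ∃ c', Reach r c c' ∧ (∀ w, c' w m = 0 ∨ c' w n = 0 → c w m = 0 ∧ c w n = 0) ∧
      ∀ w i, i ≠ m → i ≠ n → c' w i = c w i := by
  obtain ⟨t, ht0, ht⟩ := exists_ne_zero_mixture_ne_zero ((hc m).of_le hr) ((hc n).of_le hr)
  have hnorm : ‖t‖ ≠ 0 := norm_ne_zero_iff.2 ht0
  obtain ⟨c', hc', hm, hn, hi⟩ := exists_reach_interfere hmn (contDiff_zero_fun (𝕜 := ℝ))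
    (contDiff_const (c := t.arg)) (contDiff_const (c := Real.arctan (1 / ‖t‖)))
  refine ⟨c', hc', fun w h => ht w ?_, hi⟩
  have hcos : Real.cos (Real.arctan (1 / ‖t‖)) = Real.sin (Real.arctan (1 / ‖t‖)) * ‖t‖ :=
    ((sin_arctan_div_mul hnorm).trans (mul_one _)).symm
  have hsin0 : (Real.sin (Real.arctan (1 / ‖t‖)) : ℂ) ≠ 0 :=
    Complex.ofReal_ne_zero.2 <| left_ne_zero_of_mul (hcos ▸ (Real.cos_arctan_pos _).ne')
  have hzero : shifterResponse (fun _ => 0) w = 1 := shifterResponse_zero w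
  have hpolar : t = ‖t‖ * shifterResponse (fun _ => t.arg) w := by
    rw [shifterResponse, mul_comm Complex.I, Complex.norm_mul_exp_arg_mul_I]
  have hunit := Unitary.star_mul_self_of_mem (shifterResponse_mem_unitary (fun _ => t.arg) w)
  have hy0 := right_ne_zero_of_mul (hunit.trans_ne one_ne_zero)
  have hreal : star (‖t‖ : ℂ) = ‖t‖ := Complex.conj_ofReal _
  have hstar := congrArg star hpolar
  rw [star_mul', hreal] at hstar
  rw [hm, hn, hcos, hzero, Complex.ofReal_mul] at h
  generalize shifterResponse (fun _ => t.arg) w = y at *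
  refine h.imp (fun h => mul_left_cancel₀ hsin0 ?_)
    fun h => mul_left_cancel₀ (mul_ne_zero hsin0 hy0) ?_
  · linear_combination h + Real.sin (Real.arctan (1 / ‖t‖)) * c w n * hpolar
  · linear_combination h + Real.sin (Real.arctan (1 / ‖t‖)) * c w m * (y * hstar + ‖t‖ * hunit)

theorem exists_reach_merge (hc : ∀ i, ContDiff ℝ r fun w => c w i) (hmn : m ≠ n)
    (hm0 : ∀ w, c w m ≠ 0) (hn0 : ∀ w, c w n ≠ 0) :
    ∃ c', Reach r c c' ∧ (∀ w, c' w m ≠ 0) ∧ (∀ w, c' w n = 0) ∧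
      ∀ w i, i ≠ m → i ≠ n → c' w i = c w i := by
  obtain ⟨φ, hφ, hφm⟩ := exists_contDiff_phase (hc m) hm0
  obtain ⟨ψ, hψ, hψn⟩ := exists_contDiff_phase (hc n) hn0
  have hθ : ContDiff ℝ r fun w => Real.arctan (‖c w m‖ / ‖c w n‖) :=
    Real.contDiff_arctan.comp <| ((hc m).norm ℝ hm0).div ((hc n).norm ℝ hn0)
      fun w => norm_ne_zero_iff.2 (hn0 w)
  obtain ⟨c', hc', hm, hn, hi⟩ := exists_reach_interfere hmn hφ hψ hθ
  have hsin (w : ℝ) := sin_arctan_div_mul (a := ‖c w m‖) (norm_ne_zero_iff.2 (hn0 w))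
  refine ⟨c', hc', fun w => ?_, fun w => ?_, hi⟩
  · have hsin_nonneg : 0 ≤ Real.sin (Real.arctan (‖c w m‖ / ‖c w n‖)) :=
      Real.sin_arctan_nonneg.2 (by positivity)
    have hcos_pos := mul_pos (Real.cos_arctan_pos (‖c w m‖ / ‖c w n‖)) (norm_pos_iff.2 (hn0 w))
    rw [hm, hφm, hψn]
    exact_mod_cast (add_pos_of_nonneg_of_pos (mul_nonneg hsin_nonneg (norm_nonneg _)) hcos_pos).ne'
  · rw [hn, hφm, hψn, sub_eq_zero]
    exact_mod_cast (hsin w).symm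

theorem exists_reach_absorb (hr : 1 ≤ r) (hc : ∀ i, ContDiff ℝ r fun w => c w i) (hmn : m ≠ n)
    (hm0 : ∀ w, c w m ≠ 0) :
    ∃ c', Reach r c c' ∧ (∀ w, c' w m ≠ 0) ∧ (∀ w, c' w n = 0) ∧
      ∀ w i, i ≠ m → i ≠ n → c' w i = c w i := by
  obtain ⟨d, hd, hd0, hdi⟩ := exists_reach_mix hr hc hmn
  obtain ⟨e, he, hem, hen, hei⟩ := exists_reach_merge (hd.contDiff hc) hmn
    (fun w h => hm0 w (hd0 w (.inl h)).1) (fun w h => hm0 w (hd0 w (.inr h)).1)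
  exact ⟨e, hd.trans he, hem, hen, fun w i him hin => (hei w i him hin).trans (hdi w i him hin)⟩

theorem exists_reach_fill (hr : 1 ≤ r) (hc : ∀ i, ContDiff ℝ r fun w => c w i) (J : Finset (Fin N))
    (hmJ : m ∉ J) :
    ∃ c', Reach r c c' ∧ (∀ w, c' w m = 0 → c w m = 0 ∧ ∀ j ∈ J, c w j = 0) ∧
      ∀ w i, i ≠ m → i ∉ J → c' w i = c w i := by
  induction J using Finset.induction_on with
  | empty => exact ⟨c, .refl, by simp, by simp⟩
  | insert j J hjJ ih =>
    obtain ⟨hmj, hmJ⟩ : m ≠ j ∧ m ∉ J := by simpa using hmJ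
    obtain ⟨d, hd, hd0, hdi⟩ := ih hmJ
    obtain ⟨e, he, he0, hei⟩ := exists_reach_mix hr (hd.contDiff hc) hmj
    refine ⟨e, hd.trans he, fun w hw => ?_, fun w i him hi => ?_⟩
    · obtain ⟨hdm, hdj⟩ := he0 w (.inl hw)
      obtain ⟨hcm, hcJ⟩ := hd0 w hdm
      exact ⟨hcm, Finset.forall_mem_insert _ _ _ |>.2 ⟨hdi w j hmj.symm hjJ ▸ hdj, hcJ⟩⟩
    · obtain ⟨hij, hiJ⟩ : i ≠ j ∧ i ∉ J := by simpa using hi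
      rw [hei w i him hij, hdi w i him hiJ]

theorem exists_reach_clear (hr : 1 ≤ r) (hc : ∀ i, ContDiff ℝ r fun w => c w i)
    (hm0 : ∀ w, c w m ≠ 0) (J : Finset (Fin N)) (hmJ : m ∉ J) :
    ∃ c', Reach r c c' ∧ (∀ w, c' w m ≠ 0) ∧ ∀ w, ∀ j ∈ J, c' w j = 0 := by
  induction J using Finset.induction_on with
  | empty => exact ⟨c, .refl, hm0, by simp⟩
  | insert j J hjJ ih =>
    obtain ⟨hmj, hmJ⟩ : m ≠ j ∧ m ∉ J := by simpa using hmJ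
    obtain ⟨d, hd, hd0, hdJ⟩ := ih hmJ
    obtain ⟨e, he, he0, hej, hei⟩ := exists_reach_absorb hr (hd.contDiff hc) hmj hd0
    refine ⟨e, hd.trans he, he0, fun w => Finset.forall_mem_insert _ _ _ |>.2 ⟨hej w, ?_⟩⟩
    intro i hi
    rw [hei w i (ne_of_mem_of_not_mem hi hmJ) (ne_of_mem_of_not_mem hi hjJ), hdJ w i hi]

theorem exists_reach_single (hr : 1 ≤ r) (hc : ∀ i, ContDiff ℝ r fun w => c w i)
    (hc0 : ∀ w, c w ≠ 0) (m : Fin N) :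
    ∃ ρ : ℝ → ℝ, (∀ w, 0 < ρ w) ∧ Reach r c fun w => Pi.single m (ρ w : ℂ) := by
  have hm : m ∉ Finset.univ.erase m := Finset.notMem_erase _ _
  obtain ⟨d, hd, hd0, -⟩ := exists_reach_fill hr hc _ hm
  have hdm : ∀ w, d w m ≠ 0 := fun w h => hc0 w <| funext fun i => by
    obtain ⟨hcm, hci⟩ := hd0 w h
    rcases eq_or_ne i m with rfl | him
    exacts [hcm, hci i (by simpa using him)]
  obtain ⟨e, he, hem, he0⟩ := exists_reach_clear hr (hd.contDiff hc) hdm _ hm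
  obtain ⟨φ, hφ, hφm⟩ := exists_contDiff_phase (he.contDiff (hd.contDiff hc) m) hem
  refine ⟨fun w => ‖e w m‖, fun w => norm_pos_iff.2 (hem w), (hd.trans he).trans ?_⟩
  convert reach_shift m hφ using 2 with w
  ext i
  rcases eq_or_ne i m with rfl | him
  · simp [hφm]
  · simp [him, he0 w i (by simpa using him)]

end Elimination

section Universality

variable {n N : ℕ} {r : WithTop ℕ∞}

theorem eq_embed_succEmb {A : Matrix (Fin (n + 1)) (Fin (n + 1)) ℂ}
    (hA : A ∈ unitaryGroup (Fin (n + 1)) ℂ) {ρ : ℝ} (hρ : 0 < ρ)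
    (h : A.col 0 = Pi.single 0 (ρ : ℂ)) :
    A = embed (Fin.succEmb n) (A.submatrix Fin.succ Fin.succ) := by
  have hcol : ∀ i, A i 0 = Pi.single (M := fun _ => ℂ) 0 (ρ : ℂ) i := congrFun h
  have hrow : ∀ j, (ρ : ℂ) * A 0 j = (1 : Matrix (Fin (n + 1)) (Fin (n + 1)) ℂ) 0 j := fun j => by
    rw [← mem_unitaryGroup_iff'.1 hA, star_eq_conjTranspose, mul_apply, Fin.sum_univ_succ]
    simp [hcol]
  have hρ1 : ρ = 1 := by
    have h00 := hrow 0
    rw [hcol, Pi.single_eq_same, one_apply_eq] at h00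
    have hsq : ρ * ρ = 1 := by exact_mod_cast h00
    nlinarith
  have hrange : ∀ i ∉ Set.range (Fin.succEmb n), i = 0 := fun i hi =>
    by_contra fun hi0 => hi ⟨i.pred hi0, i.succ_pred hi0⟩
  refine eq_embed (fun _ _ => rfl) (fun i hi j => ?_) fun i j hj => ?_
  · rw [hrange i hi, ← hrow, hρ1, Complex.ofReal_one, one_mul]
  · rw [hrange j hj, hcol, hρ1, Complex.ofReal_one, Pi.single_apply, one_apply]

theorem mem_realizable_of_contDiff (hr : 1 ≤ r) {U : ℝ → Matrix (Fin N) (Fin N) ℂ}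
    (hU : ∀ i j, ContDiff ℝ r fun w => U w i j) (hu : ∀ w, U w ∈ unitaryGroup (Fin N) ℂ) :
    U ∈ realizable N {φ | ContDiff ℝ r φ} := by
  induction N with
  | zero =>
    obtain rfl : U = 1 := Subsingleton.elim _ _
    exact one_mem _
  | succ n ih =>
    have hcol (w : ℝ) : (U w).col 0 ≠ 0 := fun h => by
      have h00 := congrFun (congrFun (mem_unitaryGroup_iff'.1 (hu w)) 0) 0
      have hU0 : ∀ i, U w i 0 = 0 := congrFun h
      simp [mul_apply, hU0] at h00
    obtain ⟨ρ, hρ, T, hT, hTc⟩ :=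
      exists_reach_single hr (c := fun w => (U w).col 0) (fun i => hU i 0) hcol 0
    have hTu := mem_unitaryGroup_of_mem_realizable hT
    have hVu (w : ℝ) : (T * U) w ∈ unitaryGroup _ ℂ := mul_mem (hTu w) (hu w)
    have hV (w : ℝ) : (T * U) w =
        embed (Fin.succEmb n) (((T * U) w).submatrix Fin.succ Fin.succ) :=
      eq_embed_succEmb (hVu w) (hρ w) (hTc w).symm
    have hV' := ih (U := fun w => ((T * U) w).submatrix Fin.succ Fin.succ)
      (fun i j => contDiff_mul (contDiff_of_mem_realizable hT) hU i.succ j.succ)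
      fun w => (embed_mem_unitaryGroup_iff (Fin.succEmb n)).1 (hV w ▸ hVu w)
    have hstar : star T * T = 1 := funext fun w => mem_unitaryGroup_iff'.1 (hTu w)
    rw [← one_mul U, ← hstar, mul_assoc, funext hV]
    exact mul_mem (star_mem_realizable hT) (embed_mem_realizable (Fin.succEmb n) hV')

end Universality

section Cavity

theorem one_add_mul_I_ne_zero (x : ℝ) : 1 + (x : ℂ) * Complex.I ≠ 0 := fun h => by
  simpa using congrArg Complex.re h

theorem shifterResponse_two_mul_arctan (x : ℝ → ℝ) (w : ℝ) :
    shifterResponse (fun w => 2 * Real.arctan (x w)) w =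
      (1 + (x w : ℂ) * Complex.I) / (1 - (x w : ℂ) * Complex.I) := by
  have hlog : Complex.I * ((2 * Real.arctan (x w) : ℝ) : ℂ) =
      Complex.log ((1 + (x w : ℂ) * Complex.I) / (1 - (x w : ℂ) * Complex.I)) := by
    rw [Complex.ofReal_mul, Complex.ofReal_arctan, Complex.arctan]
    push_cast
    linear_combination -Complex.log _ * Complex.I_sq
  have hneg : 1 - (x w : ℂ) * Complex.I ≠ 0 := by
    simpa [← sub_eq_add_neg] using one_add_mul_I_ne_zero (-x w)
  rw [shifterResponse, hlog, Complex.exp_log (div_ne_zero (one_add_mul_I_ne_zero _) hneg)]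

theorem Cavity.response_eq_shifterResponse (c : Cavity) (w : ℝ) :
    c.response w = shifterResponse (fun w => 2 * Real.arctan ((w + c.Δ) / c.γ)) w := by
  have hγ : (c.γ : ℂ) ≠ 0 := Complex.ofReal_ne_zero.2 c.γ_pos.ne'
  rw [shifterResponse_two_mul_arctan, Cavity.response, ← mul_div_mul_left (1 + _) _ hγ]
  push_cast
  congr 1 <;> field_simp

theorem chainResponse_mem_unitary (C : List Cavity) (w : ℝ) : chainResponse C w ∈ unitary ℂ :=
  list_prod_mem fun z hz => by
    obtain ⟨c, -, rfl⟩ := List.mem_map.1 hz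
    exact c.response_eq_shifterResponse w ▸ shifterResponse_mem_unitary _ w

theorem chainResponse_append (C D : List Cavity) (w : ℝ) :
    chainResponse (C ++ D) w = chainResponse C w * chainResponse D w := by
  simp [chainResponse]

end Cavity

section PhaseApproximation

open Filter Set Topology

theorem norm_mul_sub_mul_le {R : Type*} [NormedRing R] [StarRing R] [CStarRing R] {x y u v : R}
    (hy : y ∈ unitary R) (hu : u ∈ unitary R) : ‖x * y - u * v‖ ≤ ‖x - u‖ + ‖y - v‖ := by
  rw [← CStarRing.norm_mul_mem_unitary (x - u) hy, ← CStarRing.norm_mem_unitary_mul (y - v) hu,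
    show x * y - u * v = (x - u) * y + u * (y - v) by noncomm_ring]
  exact norm_add_le _ _

theorem norm_shifterResponse_sub_le (φ ψ : ℝ → ℝ) (w : ℝ) :
    ‖shifterResponse φ w - shifterResponse ψ w‖ ≤ |φ w - ψ w| := by
  have hfactor : shifterResponse φ w - shifterResponse ψ w =
      shifterResponse ψ w * (shifterResponse (φ - ψ) w - 1) := by
    rw [mul_sub_one, ← shifterResponse_add, add_sub_cancel]
  rw [hfactor, CStarRing.norm_mem_unitary_mul _ (shifterResponse_mem_unitary ψ w)]
  exact Real.norm_exp_I_mul_ofReal_sub_one_le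

variable {ι : Type*} {l : Filter ι} {K : Set ℝ} {φ : ℝ → ℝ} {F : ι → ℝ → ℝ}

/-- The phases whose phase shifters are uniformly approximated on `K` by chains of cavities. -/
def chainApprox (K : Set ℝ) : AddSubmonoid (ℝ → ℝ) where
  carrier := {φ | ∀ ε > 0, ∃ C, ∀ w ∈ K, ‖chainResponse C w - shifterResponse φ w‖ < ε}
  zero_mem' := fun ε hε => ⟨[], fun w _ => by
    rw [shifterResponse_zero]
    simpa [chainResponse] using hε⟩
  add_mem' := by
    intro φ ψ hφ hψ ε hε
    obtain ⟨C, hC⟩ := hφ (ε / 2) (half_pos hε)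
    obtain ⟨D, hD⟩ := hψ (ε / 2) (half_pos hε)
    refine ⟨C ++ D, fun w hw => ?_⟩
    rw [chainResponse_append, shifterResponse_add]
    linarith [hC w hw, hD w hw, norm_mul_sub_mul_le (x := chainResponse C w)
      (v := shifterResponse ψ w) (chainResponse_mem_unitary D w) (shifterResponse_mem_unitary φ w)]

/-- The phases whose phase shifters are uniformly approximated on `K` by chains of cavities, up to
the response of a reference chain. -/
def relApprox (K : Set ℝ) : AddSubgroup (ℝ → ℝ) where
  carrier := {φ | ∀ ε > 0, ∃ C D, ∀ w ∈ K,
    ‖chainResponse C w - chainResponse D w * shifterResponse φ w‖ < ε}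
  zero_mem' := fun ε hε => ⟨[], [], fun w _ => by
    rw [shifterResponse_zero]
    simpa [chainResponse] using hε⟩
  add_mem' := by
    intro φ ψ hφ hψ ε hε
    obtain ⟨C, D, hC⟩ := hφ (ε / 2) (half_pos hε)
    obtain ⟨C', D', hC'⟩ := hψ (ε / 2) (half_pos hε)
    refine ⟨C ++ C', D ++ D', fun w hw => ?_⟩
    rw [chainResponse_append, chainResponse_append, shifterResponse_add, mul_mul_mul_comm]
    linarith [hC w hw, hC' w hw, norm_mul_sub_mul_le (x := chainResponse C w)
      (v := chainResponse D' w * shifterResponse ψ w) (chainResponse_mem_unitary C' w)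
      (mul_mem (chainResponse_mem_unitary D w) (shifterResponse_mem_unitary φ w))]
  neg_mem' := by
    intro φ hφ ε hε
    obtain ⟨C, D, hC⟩ := hφ ε hε
    refine ⟨D, C, fun w hw => ?_⟩
    rw [← CStarRing.norm_mul_mem_unitary _ (shifterResponse_mem_unitary φ w), sub_mul, mul_assoc,
      ← shifterResponse_add, neg_add_cancel, shifterResponse_zero, mul_one, norm_sub_rev]
    exact hC w hw

/-- The phases all of whose real multiples are in `relApprox K`. Unlike the latter, they form a
vector space. -/
def lineApprox (K : Set ℝ) : Submodule ℝ (ℝ → ℝ) where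
  carrier := {φ | ∀ s : ℝ, s • φ ∈ relApprox K}
  zero_mem' := fun s => by simp
  add_mem' {φ ψ} hφ hψ s := smul_add s φ ψ ▸ add_mem (hφ s) (hψ s)
  smul_mem' t φ hφ s := smul_smul s t φ ▸ hφ (s * t)

theorem mem_relApprox_of_mem_lineApprox (hφ : φ ∈ lineApprox K) : φ ∈ relApprox K :=
  one_smul ℝ φ ▸ hφ 1

theorem mem_relApprox_of_mem_chainApprox (hφ : φ ∈ chainApprox K) : φ ∈ relApprox K := fun ε hε =>
  (hφ ε hε).imp fun C hC => ⟨[], fun w hw => by simpa [chainResponse] using hC w hw⟩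

theorem mem_chainApprox_of_tendstoUniformlyOn [l.NeBot] (hF : ∀ᶠ i in l, F i ∈ chainApprox K)
    (h : TendstoUniformlyOn F φ l K) : φ ∈ chainApprox K := by
  intro ε hε
  obtain ⟨i, hi, hiφ⟩ := (hF.and (Metric.tendstoUniformlyOn_iff.1 h _ (half_pos hε))).exists
  obtain ⟨C, hC⟩ := hi (ε / 2) (half_pos hε)
  refine ⟨C, fun w hw => ?_⟩
  have hφ := hiφ w hw
  rw [dist_comm, Real.dist_eq] at hφ
  linarith [hC w hw, norm_shifterResponse_sub_le (F i) φ w, norm_sub_le_norm_sub_add_norm_sub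
    (chainResponse C w) (shifterResponse (F i) w) (shifterResponse φ w)]

theorem mem_relApprox_of_tendstoUniformlyOn [l.NeBot] (hF : ∀ᶠ i in l, F i ∈ relApprox K)
    (h : TendstoUniformlyOn F φ l K) : φ ∈ relApprox K := by
  intro ε hε
  obtain ⟨i, hi, hiφ⟩ := (hF.and (Metric.tendstoUniformlyOn_iff.1 h _ (half_pos hε))).exists
  obtain ⟨C, D, hC⟩ := hi (ε / 2) (half_pos hε)
  refine ⟨C, D, fun w hw => ?_⟩
  have hφ := hiφ w hw
  rw [dist_comm, Real.dist_eq] at hφ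
  have htri := norm_sub_le_norm_sub_add_norm_sub (chainResponse C w)
    (chainResponse D w * shifterResponse (F i) w) (chainResponse D w * shifterResponse φ w)
  rw [← mul_sub (chainResponse D w),
    CStarRing.norm_mem_unitary_mul _ (chainResponse_mem_unitary D w)] at htri
  linarith [hC w hw, norm_shifterResponse_sub_le (F i) φ w]

theorem mem_lineApprox_of_tendstoUniformlyOn [l.NeBot] (hF : ∀ᶠ i in l, F i ∈ lineApprox K)
    (h : TendstoUniformlyOn F φ l K) : φ ∈ lineApprox K := fun s =>
  mem_relApprox_of_tendstoUniformlyOn (F := fun i => s • F i) (hF.mono fun _ hi => hi s)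
    ((lipschitzWith_smul s).uniformContinuous.comp_tendstoUniformlyOn h)

theorem tendstoUniformlyOn_of_continuous {α : Type*} [TopologicalSpace α] {f : α → ℝ → ℝ}
    {x : ι → α} {q : α} (hK : IsCompact K) (hf : Continuous f.uncurry)
    (hx : Tendsto x l (𝓝 q)) : TendstoUniformlyOn (fun i => f (x i)) (f q) l K := by
  refine Metric.tendstoUniformlyOn_iff.2 fun ε hε => ?_
  obtain ⟨v, hv, h⟩ := hK.mem_uniformity_of_prod (s := univ) hf.continuousOn (mem_univ q)
    (Metric.dist_mem_uniformity hε)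
  rw [nhdsWithin_univ] at hv
  filter_upwards [hx hv] with i hi w hw
  exact dist_comm (f q w) (f (x i) w) ▸ h (x i) hi w hw

theorem two_mul_arctan_mem_chainApprox {t : ℝ} (ht : 0 < t) (δ : ℝ) :
    (fun w => 2 * Real.arctan (t * w + δ)) ∈ chainApprox K := fun ε hε =>
  ⟨[⟨1 / t, one_div_pos.2 ht, δ / t⟩], fun w _ => by
    have hx : (w + δ / t) / (1 / t) = t * w + δ := by field_simp
    rw [chainResponse, List.map_singleton, List.prod_singleton, Cavity.response_eq_shifterResponse]
    simpa only [shifterResponse, hx, sub_self, norm_zero] using hε⟩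

theorem const_mem_chainApprox (hK : IsCompact K) (θ : ℝ) : (fun _ => θ) ∈ chainApprox K := by
  have harctan (δ : ℝ) : (fun _ => 2 * Real.arctan δ) ∈ chainApprox K := by
    have hlim := tendstoUniformlyOn_of_continuous (f := fun t w => 2 * Real.arctan (t * w + δ)) hK
      (by fun_prop) (tendsto_id'.2 (nhdsWithin_le_nhds (a := 0) (s := Ioi 0)))
    simp only [zero_mul, zero_add] at hlim
    exact mem_chainApprox_of_tendstoUniformlyOn (l := 𝓝[>] 0)
      (eventually_mem_nhdsWithin.mono fun t ht => two_mul_arctan_mem_chainApprox ht δ) hlim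
  obtain ⟨n, hn⟩ := exists_nat_gt (|θ| / Real.pi)
  have hn0 : (0 : ℝ) < n := lt_of_le_of_lt (by positivity) hn
  have hlt : |θ / n| < Real.pi := by
    rwa [abs_div, Nat.abs_cast, div_lt_comm₀ hn0 Real.pi_pos]
  have hθ : (fun _ => θ) = n • fun _ : ℝ => 2 * Real.arctan (Real.tan (θ / n / 2)) := by
    funext w
    rw [abs_lt] at hlt
    rw [Real.arctan_tan (by linarith) (by linarith), Pi.smul_apply, nsmul_eq_mul]
    field_simp
  exact hθ ▸ nsmul_mem (harctan _) n

theorem two_mul_arctan_mem_relApprox (hK : IsCompact K) (t δ : ℝ) :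
    (fun w => 2 * Real.arctan (t * w + δ)) ∈ relApprox K := by
  rcases lt_trichotomy t 0 with ht | rfl | ht
  · have hneg : (fun w => 2 * Real.arctan (t * w + δ)) =
        -fun w => 2 * Real.arctan (-t * w + -δ) := by
      funext w
      rw [Pi.neg_apply, ← mul_neg, ← Real.arctan_neg]
      ring_nf
    rw [hneg]
    exact neg_mem (mem_relApprox_of_mem_chainApprox
      (two_mul_arctan_mem_chainApprox (neg_pos.2 ht) _))
  · simpa using mem_relApprox_of_mem_chainApprox (const_mem_chainApprox hK (2 * Real.arctan δ))
  · exact mem_relApprox_of_mem_chainApprox (two_mul_arctan_mem_chainApprox ht δ)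

-- A difference quotient with step `s / n` is `n` times a phase of the group, over `s`.
theorem deriv_mem_lineApprox (hK : IsCompact K) {φ φ' : ℝ → ℝ → ℝ}
    (hd : ∀ t w, HasDerivAt (fun t => φ t w) (φ' t w) t) (hφ' : Continuous φ'.uncurry)
    (hφ : ∀ t, φ t ∈ relApprox K) (t : ℝ) : φ' t ∈ lineApprox K := by
  intro s
  let G : ℝ → ℝ → ℝ := fun h w => ∫ u in (0 : ℝ)..1, φ' (t + u • h) w
  have hG (h w : ℝ) : h * G h w = φ (t + h) w - φ t w :=
    intervalIntegral.integral_unitInterval_deriv_eq_sub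
      (f' := fun t => φ' t w) (Continuous.continuousOn (by fun_prop)) fun u _ => hd _ w
  have hGcont : Continuous G.uncurry :=
    intervalIntegral.continuous_parametric_intervalIntegral_of_continuous'
      (f := fun (p : ℝ × ℝ) u => φ' (t + u • p.1) p.2) (by fun_prop) 0 1
  have hG0 : G 0 = φ' t := by
    funext w
    simp [G]
  have hlim := tendstoUniformlyOn_of_continuous (f := fun h w => s * G h w) hK (by fun_prop)
    (tendsto_const_div_atTop_nhds_zero_nat s)
  rw [hG0] at hlim
  refine mem_relApprox_of_tendstoUniformlyOn ?_ hlim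
  filter_upwards [eventually_ne_atTop 0] with n hn
  have hquot : (fun w => s * G (s / n) w) = n • (φ (t + s / n) - φ t) := by
    funext w
    rw [Pi.smul_apply, Pi.sub_apply, ← hG, nsmul_eq_mul]
    field_simp
  exact hquot ▸ nsmul_mem (sub_mem (hφ _) (hφ _)) n

/-- The phases `φ` whose quotients by `1 + (t w) ^ 2` are in `lineApprox K` for all `t`; a phase in
this space stays in it when multiplied by `w ^ 2`. -/
def resolventApprox (K : Set ℝ) : Set (ℝ → ℝ) :=
  {φ | ∀ t : ℝ, t ≠ 0 → (fun w => φ w / (1 + (t * w) ^ 2)) ∈ lineApprox K}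

theorem one_add_sq_ne_zero (x : ℝ) : 1 + x ^ 2 ≠ 0 := by positivity

theorem mem_lineApprox_of_mem_resolventApprox (hK : IsCompact K) (hcont : Continuous φ)
    (hφ : φ ∈ resolventApprox K) : φ ∈ lineApprox K := by
  have hlim := tendstoUniformlyOn_of_continuous (f := fun t w => φ w / (1 + (t * w) ^ 2)) hK
    (by fun_prop (disch := intro; exact one_add_sq_ne_zero _))
    (tendsto_id'.2 (nhdsWithin_le_nhds (a := 0) (s := {0}ᶜ)))
  simp only [zero_mul, zero_pow two_ne_zero, add_zero, div_one] at hlim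
  exact mem_lineApprox_of_tendstoUniformlyOn (l := 𝓝[≠] 0) (eventually_mem_nhdsWithin.mono hφ) hlim

theorem mul_sq_mem_resolventApprox (hK : IsCompact K) (hcont : Continuous φ)
    (hφ : φ ∈ resolventApprox K) : (fun w => φ w * w ^ 2) ∈ resolventApprox K := by
  intro t ht
  have hsplit : (fun w => φ w * w ^ 2 / (1 + (t * w) ^ 2)) =
      (t ^ 2)⁻¹ • (φ - fun w => φ w / (1 + (t * w) ^ 2)) := by
    funext w
    have := one_add_sq_ne_zero (t * w)
    simp only [Pi.smul_apply, Pi.sub_apply, smul_eq_mul]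
    field_simp
    ring
  rw [hsplit]
  exact Submodule.smul_mem _ _
    (sub_mem (mem_lineApprox_of_mem_resolventApprox hK hcont hφ) (hφ t ht))

theorem one_mem_resolventApprox (hK : IsCompact K) : (fun _ => 1) ∈ resolventApprox K := by
  intro t _
  have hderiv := deriv_mem_lineApprox hK (φ := fun δ w => 2 * Real.arctan (t * w + δ))
    (φ' := fun δ w => 2 * (1 / (1 + (t * w + δ) ^ 2)))
    (fun δ w => by simpa using (((hasDerivAt_id δ).const_add (t * w)).arctan).const_mul 2)
    (by fun_prop (disch := intro; exact one_add_sq_ne_zero _))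
    (two_mul_arctan_mem_relApprox hK t) 0
  simpa [Pi.smul_def] using Submodule.smul_mem _ (2⁻¹ : ℝ) hderiv

theorem id_mem_resolventApprox (hK : IsCompact K) : (fun w => w) ∈ resolventApprox K := by
  intro t _
  have hderiv := deriv_mem_lineApprox hK (φ := fun t w => 2 * Real.arctan (t * w))
    (φ' := fun t w => 2 * (w / (1 + (t * w) ^ 2)))
    (fun t w => by
      simpa [div_eq_inv_mul] using (((hasDerivAt_id t).mul_const w).arctan).const_mul 2)
    (by fun_prop (disch := intro; exact one_add_sq_ne_zero _))
    (fun t => by simpa using two_mul_arctan_mem_relApprox hK t 0) t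
  simpa [Pi.smul_def] using Submodule.smul_mem _ (2⁻¹ : ℝ) hderiv

theorem pow_mem_resolventApprox (hK : IsCompact K) (n : ℕ) :
    (fun w => w ^ n) ∈ resolventApprox K := by
  induction n using Nat.twoStepInduction with
  | zero => simpa using one_mem_resolventApprox hK
  | one => simpa using id_mem_resolventApprox hK
  | more n ih _ =>
    simpa only [pow_add] using mul_sq_mem_resolventApprox hK (continuous_pow n) ih

theorem mem_relApprox_of_continuous (hφ : Continuous φ) (a b : ℝ) : φ ∈ relApprox (Icc a b) := by
  have hpoly (p : Polynomial ℝ) : (fun w => p.eval w) ∈ lineApprox (Icc a b) := by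
    have hsum : (fun w => p.eval w) =
        ∑ i ∈ Finset.range (p.natDegree + 1), p.coeff i • fun w => w ^ i := by
      funext w
      simp [Polynomial.eval_eq_sum_range]
    rw [hsum]
    exact sum_mem fun i _ => Submodule.smul_mem _ _ (mem_lineApprox_of_mem_resolventApprox
      isCompact_Icc (continuous_pow i) (pow_mem_resolventApprox isCompact_Icc i))
  choose p hp using fun n : ℕ => exists_polynomial_near_of_continuousOn a b φ hφ.continuousOn
    (1 / (n + 1 : ℝ)) Nat.one_div_pos_of_nat
  refine mem_relApprox_of_mem_lineApprox (mem_lineApprox_of_tendstoUniformlyOn (l := atTop)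
    (F := fun n w => (p n).eval w) (Eventually.of_forall fun n => hpoly (p n)) ?_)
  refine Metric.tendstoUniformlyOn_iff.2 fun ε hε => ?_
  filter_upwards [tendsto_one_div_add_atTop_nhds_zero_nat.eventually_lt_const hε] with n hn w hw
  rw [dist_comm, Real.dist_eq]
  exact (hp n w hw).trans hn

end PhaseApproximation

section MeshApproximation

open scoped Matrix.Norms.L2Operator

variable {N : ℕ} {K : Set ℝ} {a b ε : ℝ}

theorem norm_apply_le_l2_opNorm (A : Matrix (Fin N) (Fin N) ℂ) (i j : Fin N) : ‖A i j‖ ≤ ‖A‖ := by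
  have h := A.l2_opNorm_mulVec (EuclideanSpace.single j 1)
  rw [PiLp.norm_single, norm_one, mul_one] at h
  simpa using (PiLp.norm_apply_le _ i).trans h

theorem norm_diagonal_sub_lt {d e : Fin N → ℂ} (hε : 0 < ε) (h : ∀ i, ‖d i - e i‖ < ε) :
    ‖diagonal d - diagonal e‖ < ε := by
  rw [diagonal_sub, l2_opNorm_diagonal]
  exact (pi_norm_lt_iff hε).2 h

theorem norm_onMode_sub_lt {z z' : ℂ} (m : Fin N) (hε : 0 < ε) (h : ‖z - z'‖ < ε) :
    ‖onMode m z - onMode m z'‖ < ε :=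
  norm_diagonal_sub_lt hε fun i => by split_ifs <;> simpa using ‹_›

theorem Mesh.transfer_map_single {P : Type} (resp : P → ℝ → ℂ) (g : Fin N → P)
    {l : List (Fin N)} (hl : l.Nodup) (w : ℝ) :
    Mesh.transfer resp (l.map fun i => Element.single i (g i)) w =
      diagonal fun i => if i ∈ l then resp (g i) w else 1 := by
  induction l with
  | nil => simp [Mesh.transfer]
  | cons k l ih =>
    rw [List.nodup_cons] at hl
    rw [List.map_cons, Mesh.transfer_cons, ih hl.2, Element.transfer, onMode,
      diagonal_mul_diagonal]
    congr 1 with i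
    by_cases hik : i = k
    · simp [hik, hl.1]
    · simp [hik]

/-- The unitary transformations which are uniformly approximated on `K` by meshes of 50:50
beamsplitters and chains of cavities, up to the response of a reference chain. -/
noncomputable def relMeshApprox (N : ℕ) (K : Set ℝ) :
    Submonoid (ℝ → Matrix (Fin N) (Fin N) ℂ) where
  carrier := {U | (∀ w, U w ∈ unitaryGroup (Fin N) ℂ) ∧
    ∀ ε > 0, ∃ (D : List Cavity) (M : Mesh N (List Cavity)), ∀ w ∈ K,
      ‖M.transfer chainResponse w - chainResponse D w • U w‖ < ε}
  one_mem' := ⟨fun _ => one_mem _, fun ε hε => ⟨[], [], fun w _ => by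
    simpa [Mesh.transfer, chainResponse] using hε⟩⟩
  mul_mem' := by
    rintro U V ⟨hU, hU'⟩ ⟨hV, hV'⟩
    refine ⟨fun w => mul_mem (hU w) (hV w), fun ε hε => ?_⟩
    obtain ⟨D, M, hM⟩ := hU' (ε / 2) (half_pos hε)
    obtain ⟨D', M', hM'⟩ := hV' (ε / 2) (half_pos hε)
    refine ⟨D ++ D', M ++ M', fun w hw => ?_⟩
    have hDU : chainResponse D w • U w ∈ unitaryGroup (Fin N) ℂ :=
      Unitary.smul_mem_of_mem (chainResponse_mem_unitary D w) (hU w)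
    rw [Mesh.transfer_append, chainResponse_append, Pi.mul_apply, ← smul_mul_smul_comm]
    linarith [hM w hw, hM' w hw, norm_mul_sub_mul_le (x := M.transfer chainResponse w)
      (v := chainResponse D' w • V w)
      (M'.transfer_mem_unitaryGroup fun C => chainResponse_mem_unitary C w) hDU]

-- To imitate a phase shifter on one mode, the reference chain is placed on all the other modes.
theorem realizable_relApprox_le (N : ℕ) (K : Set ℝ) :
    realizable N (relApprox K) ≤ relMeshApprox N K := by
  refine realizable_le (fun m n hmn => ?_) fun m φ hφ => ?_
  · refine ⟨fun _ => beamSplitter_mem_unitaryGroup hmn, fun ε hε => ?_⟩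
    exact ⟨[], [.splitter m n hmn], fun w _ => by
      simpa [Mesh.transfer, Element.transfer, chainResponse] using hε⟩
  · refine ⟨fun w => onMode_mem_unitaryGroup m (shifterResponse_mem_unitary φ w), fun ε hε => ?_⟩
    obtain ⟨C, D, hC⟩ := hφ ε hε
    refine ⟨D, Finset.univ.toList.map fun i => .single i (if i = m then C else D),
      fun w hw => ?_⟩
    rw [Mesh.transfer_map_single _ _ (Finset.nodup_toList _)]
    simp only [onMode, ← diagonal_smul]
    refine norm_diagonal_sub_lt hε fun i => ?_
    by_cases hi : i = m
    · simpa [hi] using hC w hw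
    · simpa [hi] using hε

theorem Element.exists_replaces {e : Element N (ℝ → ℝ)}
    (he : ∀ m φ, e = .single m φ → φ ∈ chainApprox (Set.Icc a b)) (hε : 0 < ε) :
    ∃ e' : Element N (List Cavity), Replaces a b ε e e' ∧ ∀ w ∈ Set.Icc a b,
      ‖e'.transfer chainResponse w - e.transfer shifterResponse w‖ < ε := by
  cases e with
  | splitter m n hmn =>
    exact ⟨_, .splitter m n hmn, fun w _ => by simpa [Element.transfer] using hε⟩
  | single m φ =>
    obtain ⟨C, hC⟩ := he m φ rfl ε hε
    exact ⟨_, .single m φ C hC, fun w hw => norm_onMode_sub_lt m hε (hC w hw)⟩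

theorem Replaces.mono {ε' : ℝ} (h : ε ≤ ε') {e : Element N (ℝ → ℝ)} {e' : Element N (List Cavity)} :
    Replaces a b ε e e' → Replaces a b ε' e e'
  | .splitter m n hmn => .splitter m n hmn
  | .single m φ C hC => .single m φ C fun w hw => (hC w hw).trans_le h

theorem Mesh.exists_replaces {M : Mesh N (ℝ → ℝ)}
    (hM : M.AllSingle (· ∈ chainApprox (Set.Icc a b))) (hε : 0 < ε) :
    ∃ M' : Mesh N (List Cavity), List.Forall₂ (Replaces a b ε) M M' ∧ ∀ w ∈ Set.Icc a b,
      ‖M'.transfer chainResponse w - M.transfer shifterResponse w‖ < ε := by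
  induction M generalizing ε with
  | nil => exact ⟨[], .nil, fun w _ => by simpa [Mesh.transfer] using hε⟩
  | cons e M ih =>
    obtain ⟨e', hee', he'⟩ := Element.exists_replaces
      (fun m φ h => hM m φ (h ▸ List.mem_cons_self)) (half_pos hε)
    obtain ⟨M', hMM', hM'⟩ := ih (fun m φ h => hM m φ (List.mem_cons_of_mem e h)) (half_pos hε)
    refine ⟨e' :: M', .cons (hee'.mono (half_le_self hε.le))
      (hMM'.imp fun _ _ => Replaces.mono (half_le_self hε.le)), fun w hw => ?_⟩
    rw [Mesh.transfer_cons, Mesh.transfer_cons]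
    linarith [he' w hw, hM' w hw, norm_mul_sub_mul_le (x := e'.transfer chainResponse w)
      (v := Mesh.transfer shifterResponse M w)
      (Mesh.transfer_mem_unitaryGroup (fun C => chainResponse_mem_unitary C w) M')
      (e.transfer_mem_unitaryGroup fun φ => shifterResponse_mem_unitary φ w)]

end MeshApproximation

section CavityPhases

/-- The real-analytic phases which are uniformly approximated on every band by those of chains of
cavities, without any reference chain. -/
def cavityPhases : Set (ℝ → ℝ) :=
  {φ | ContDiff ℝ ω φ ∧ ∀ a b, φ ∈ chainApprox (Set.Icc a b)}

theorem const_mem_cavityPhases (θ : ℝ) : (fun _ => θ) ∈ cavityPhases :=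
  ⟨contDiff_const, fun _ _ => const_mem_chainApprox isCompact_Icc θ⟩

theorem two_mul_arctan_mem_cavityPhases {t : ℝ} (ht : 0 < t) (δ : ℝ) :
    (fun w => 2 * Real.arctan (t * w + δ)) ∈ cavityPhases :=
  ⟨contDiff_const.mul (Real.contDiff_arctan.comp ((contDiff_const.mul contDiff_id).add
    contDiff_const)), fun _ _ => two_mul_arctan_mem_chainApprox ht δ⟩

variable {N : ℕ}

theorem onMode_cavity_mem_realizable (m : Fin N) (c : Cavity) :
    (fun w => onMode m (c.response w)) ∈ realizable N cavityPhases := by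
  simp only [c.response_eq_shifterResponse]
  refine onMode_mem_realizable m ?_
  simpa only [div_eq_inv_mul, mul_add] using
    two_mul_arctan_mem_cavityPhases (inv_pos.2 c.γ_pos) (c.γ⁻¹ * c.Δ)

theorem unitary_const_mem_realizable {A : Matrix (Fin N) (Fin N) ℂ}
    (hA : A ∈ unitaryGroup (Fin N) ℂ) : (fun _ => A) ∈ realizable N cavityPhases :=
  const_mem_realizable (U := fun _ => A) 0 (fun φ _ => const_mem_cavityPhases (φ 0))
    (mem_realizable_of_contDiff (r := ω) le_top (fun _ _ => contDiff_const) fun _ => hA)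

theorem exists_unitary_mulVec_eq_single (s : Fin N) {v : Fin N → ℂ} (hv : v ≠ 0) :
    ∃ A ∈ unitaryGroup (Fin N) ℂ, ∃ ρ : ℝ, 0 < ρ ∧ A *ᵥ v = Pi.single s (ρ : ℂ) := by
  obtain ⟨ρ, hρ, T, hT, hTv⟩ := exists_reach_single (r := ω) (c := fun _ => v) le_top
    (fun _ => contDiff_const) (fun _ => hv) s
  exact ⟨T 0, mem_unitaryGroup_of_mem_realizable hT 0, ρ 0, hρ 0, (hTv 0).symm⟩

end CavityPhases

section IsLossless

variable {N : ℕ} {κ κ' : Type*} [Fintype κ] [Fintype κ']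

/-- The linear system with the internal states `κ`, the drift `-M` and the coupling `C` to the `N`
external modes is damped through these modes only, and all its states are damped. This is what
makes its transfer function unitary. -/
structure IsLossless (M : Matrix κ κ ℂ) (C : Matrix (Fin N) κ ℂ) : Prop where
  add_conjTranspose : M + Mᴴ = Cᴴ * C
  injective : Function.Injective C.mulVec

variable {M : Matrix κ κ ℂ} {C : Matrix (Fin N) κ ℂ}
variable {M' : Matrix κ' κ' ℂ} {C' : Matrix (Fin N) κ' ℂ} {K : Matrix κ' κ ℂ}

theorem IsLossless.of_fromBlocks (h : IsLossless (fromBlocks M 0 K M') (fromCols C C')) :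
    IsLossless M C ∧ K = C'ᴴ * C ∧ IsLossless M' C' := by
  have hadd := h.add_conjTranspose
  rw [fromBlocks_conjTranspose, fromBlocks_add, conjTranspose_fromCols_eq_fromRows_conjTranspose,
    fromRows_mul_fromCols, fromBlocks_inj, conjTranspose_zero, add_zero] at hadd
  refine ⟨⟨hadd.1, fun u v huv => ?_⟩, hadd.2.2.1, ⟨hadd.2.2.2, fun u v huv => ?_⟩⟩
  · have huv' : Sum.elim u (0 : κ' → ℂ) = Sum.elim v (0 : κ' → ℂ) := h.injective <| by
      simpa only [fromCols_mulVec_sumElim, mulVec_zero, add_zero] using huv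
    simpa using congrArg (fun f i => f (Sum.inl i)) huv'
  · have huv' : Sum.elim (0 : κ → ℂ) u = Sum.elim (0 : κ → ℂ) v := h.injective <| by
      simpa only [fromCols_mulVec_sumElim, mulVec_zero, zero_add] using huv
    simpa using congrArg (fun f i => f (Sum.inr i)) huv'

theorem IsLossless.change_states [DecidableEq κ'] (h : IsLossless M C) {A : Matrix κ' κ ℂ}
    (hA : A * Aᴴ = 1) : IsLossless (A * M * Aᴴ) (C * Aᴴ) where
  add_conjTranspose := by
    calc A * M * Aᴴ + (A * M * Aᴴ)ᴴ = A * (M + Mᴴ) * Aᴴ := by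
          simp only [conjTranspose_mul, conjTranspose_conjTranspose, Matrix.mul_add, Matrix.add_mul,
            Matrix.mul_assoc]
      _ = (C * Aᴴ)ᴴ * (C * Aᴴ) := by
          simp only [h.add_conjTranspose, conjTranspose_mul, conjTranspose_conjTranspose,
            Matrix.mul_assoc]
  injective u v huv := by
    have hAuv : Aᴴ *ᵥ u = Aᴴ *ᵥ v := h.injective <| by simpa only [mulVec_mulVec] using huv
    simpa only [mulVec_mulVec, hA, one_mulVec] using congrArg (A *ᵥ ·) hAuv

theorem IsLossless.mul_left (h : IsLossless M C) {A : Matrix (Fin N) (Fin N) ℂ}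
    (hA : A ∈ unitaryGroup (Fin N) ℂ) : IsLossless M (A * C) := by
  have hA' : Aᴴ * A = 1 := mem_unitaryGroup_iff'.1 hA
  refine ⟨?_, fun u v huv => h.injective ?_⟩
  · rw [h.add_conjTranspose, conjTranspose_mul, Matrix.mul_assoc, ← Matrix.mul_assoc Aᴴ, hA',
      Matrix.one_mul]
  · simpa only [mulVec_mulVec, ← Matrix.mul_assoc, hA', Matrix.one_mul] using
      congrArg (Aᴴ *ᵥ ·) huv

-- If `M v = iw v`, then `‖C v‖² = ⟨v, (M + Mᴴ) v⟩ = 0`.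
theorem IsLossless.isUnit_sub [DecidableEq κ] (h : IsLossless M C) (w : ℝ) :
    IsUnit (M - (Complex.I * w) • (1 : Matrix κ κ ℂ)) := by
  rw [← mulVec_injective_iff_isUnit, ← coe_mulVecLin, ← LinearMap.ker_eq_bot, LinearMap.ker_eq_bot']
  intro v hv
  have hMv : M *ᵥ v = (Complex.I * w) • v := by
    simpa [sub_mulVec, smul_mulVec, sub_eq_zero] using hv
  have hCv : star (C *ᵥ v) ⬝ᵥ (C *ᵥ v) = 0 := by
    calc star (C *ᵥ v) ⬝ᵥ (C *ᵥ v) = star v ⬝ᵥ ((M + Mᴴ) *ᵥ v) := by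
          rw [h.add_conjTranspose, star_mulVec, ← dotProduct_mulVec, mulVec_mulVec]
      _ = star v ⬝ᵥ (M *ᵥ v) + star (M *ᵥ v) ⬝ᵥ v := by
          rw [add_mulVec, dotProduct_add, star_mulVec, ← dotProduct_mulVec]
      _ = 0 := by simp [hMv]
  open scoped ComplexOrder in
  exact h.injective ((dotProduct_star_self_eq_zero.1 hCv).trans (mulVec_zero C).symm)

end IsLossless

section AllPass

variable {N : ℕ} {κ κ' : Type*} [Fintype κ] [DecidableEq κ] [Fintype κ'] [DecidableEq κ']

/-- The transfer function `1 - C (M - iw)⁻¹ Cᴴ` of the linear system with the internal states `κ`,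
the drift `-M` and the coupling `C` to the `N` external modes. -/
noncomputable def allPass (M : Matrix κ κ ℂ) (C : Matrix (Fin N) κ ℂ) (w : ℝ) :
    Matrix (Fin N) (Fin N) ℂ :=
  1 - C * (M - (Complex.I * w) • (1 : Matrix κ κ ℂ))⁻¹ * Cᴴ

variable {M : Matrix κ κ ℂ} {C : Matrix (Fin N) κ ℂ}
variable {M' : Matrix κ' κ' ℂ} {C' : Matrix (Fin N) κ' ℂ} {K : Matrix κ' κ ℂ}

theorem IsLossless.allPass_change_states (h : IsLossless M C) {A : Matrix κ' κ ℂ}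
    (hA : Aᴴ * A = 1) (hA' : A * Aᴴ = 1) (w : ℝ) :
    allPass (A * M * Aᴴ) (C * Aᴴ) w = allPass M C w := by
  set R := M - (Complex.I * w) • (1 : Matrix κ κ ℂ) with hR
  have hAR : A * M * Aᴴ - (Complex.I * w) • (1 : Matrix κ' κ' ℂ) = A * R * Aᴴ := by
    rw [hR, Matrix.mul_sub, Matrix.sub_mul, Matrix.mul_smul, Matrix.smul_mul, Matrix.mul_one, hA']
  have hinv : (A * R * Aᴴ)⁻¹ = A * R⁻¹ * Aᴴ := by
    refine inv_eq_right_inv ?_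
    calc A * R * Aᴴ * (A * R⁻¹ * Aᴴ) = A * (R * (Aᴴ * A) * R⁻¹) * Aᴴ := by
          simp only [Matrix.mul_assoc]
      _ = 1 := by
          rw [hA, Matrix.mul_one, mul_nonsing_inv _ ((isUnit_iff_isUnit_det R).1 (h.isUnit_sub w)),
            Matrix.mul_one, hA']
  calc allPass (A * M * Aᴴ) (C * Aᴴ) w = 1 - C * (Aᴴ * A) * R⁻¹ * (Aᴴ * A) * Cᴴ := by
        rw [allPass, hAR, hinv, conjTranspose_mul, conjTranspose_conjTranspose]
        simp only [Matrix.mul_assoc]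
    _ = allPass M C w := by rw [hA, Matrix.mul_one, Matrix.mul_one, allPass]

theorem IsLossless.allPass_fromBlocks
    (h : IsLossless (fromBlocks M 0 K M') (fromCols C C')) (w : ℝ) :
    allPass (fromBlocks M 0 K M') (fromCols C C') w = allPass M' C' w * allPass M C w := by
  obtain ⟨hM, rfl, hM'⟩ := h.of_fromBlocks
  have hsub : fromBlocks M 0 (C'ᴴ * C) M' - (Complex.I * w) • (1 : Matrix (κ ⊕ κ') (κ ⊕ κ') ℂ) =
      fromBlocks (M - (Complex.I * w) • 1) 0 (C'ᴴ * C) (M' - (Complex.I * w) • 1) := by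
    rw [← fromBlocks_one, fromBlocks_smul, sub_eq_add_neg, fromBlocks_neg, fromBlocks_add]
    simp [sub_eq_add_neg]
  rw [allPass, hsub, inv_fromBlocks_zero₁₂_of_isUnit_iff _ _ _
      (iff_of_true (hM.isUnit_sub w) (hM'.isUnit_sub w)),
    conjTranspose_fromCols_eq_fromRows_conjTranspose, fromCols_mul_fromBlocks,
    fromCols_mul_fromRows, allPass, allPass]
  simp only [Matrix.mul_sub, Matrix.sub_mul, Matrix.mul_one, Matrix.one_mul, Matrix.mul_neg,
    Matrix.add_mul, Matrix.neg_mul, Matrix.mul_assoc, Matrix.mul_zero, zero_add]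
  abel

theorem allPass_mul_left {A : Matrix (Fin N) (Fin N) ℂ} (hA : A ∈ unitaryGroup (Fin N) ℂ)
    (w : ℝ) : allPass M (A * C) w = A * allPass M C w * Aᴴ := by
  have hA' : A * Aᴴ = 1 := mem_unitaryGroup_iff.1 hA
  simp only [allPass, Matrix.mul_sub, Matrix.sub_mul, Matrix.mul_one, hA', conjTranspose_mul,
    Matrix.mul_assoc]

end AllPass

section Realization

variable {N : ℕ}

theorem allPass_replicateCol_single (M : Matrix (Fin 1) (Fin 1) ℂ) (s : Fin N) (z : ℂ) (w : ℝ) :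
    allPass M (replicateCol (Fin 1) (Pi.single s z)) w =
      onMode s (1 - z * (M 0 0 - Complex.I * w)⁻¹ * star z) := by
  rw [allPass, inv_subsingleton]
  ext i j
  rw [onMode, Matrix.sub_apply, mul_apply]
  simp only [Fin.sum_univ_one, mul_diagonal, one_apply, diagonal_apply, conjTranspose_apply,
    replicateCol_apply, Pi.single_apply, Ring.inverse_eq_inv', Matrix.sub_apply, Matrix.smul_apply,
    smul_eq_mul, apply_ite star, star_zero]
  grind

theorem Cavity.exists_neg_response_eq {m : ℂ} {ρ : ℝ} (hρ : 0 < ρ)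
    (hm : m + starRingEnd ℂ m = ρ * ρ) :
    ∃ c : Cavity, ∀ w : ℝ, -c.response w = 1 - ρ * (m - Complex.I * w)⁻¹ * ρ := by
  have hre : m.re = ρ * ρ / 2 := by
    rw [Complex.add_conj] at hm
    rw [eq_div_iff two_ne_zero, mul_comm]
    exact_mod_cast hm
  have hre0 : 0 < m.re := by rw [hre]; positivity
  refine ⟨⟨m.re, hre0, -m.im⟩, fun w => ?_⟩
  have hden : (m.re : ℂ) - Complex.I * (w + (-m.im : ℝ)) = m - Complex.I * w := by
    apply Complex.ext <;> simp [sub_eq_add_neg]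
  have hnum : (m.re : ℂ) + Complex.I * (w + (-m.im : ℝ)) = starRingEnd ℂ m + Complex.I * w := by
    apply Complex.ext <;> simp [add_comm]
  have hne : m - Complex.I * w ≠ 0 := fun h0 => hre0.ne' <| by
    simpa using congrArg Complex.re h0
  rw [Cavity.response, hden, hnum]
  field_simp
  linear_combination -hm

theorem IsLossless.allPass_mem_realizable_one {M : Matrix (Fin 1) (Fin 1) ℂ}
    {C : Matrix (Fin N) (Fin 1) ℂ} (h : IsLossless M C) :
    allPass M C ∈ realizable N cavityPhases := by
  have hC : C = replicateCol (Fin 1) (C.col 0) := by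
    ext i j
    rw [Subsingleton.elim j 0, replicateCol_apply, col_apply]
  have hc : C.col 0 ≠ 0 := fun h0 => by
    have h1 : Pi.single (0 : Fin 1) (1 : ℂ) = 0 := h.injective <| by
      rw [mulVec_single_one, h0, mulVec_zero]
    simp at h1
  obtain ⟨s, -⟩ := Function.ne_iff.1 hc
  obtain ⟨A, hA, ρ, hρ, hAc⟩ := exists_unitary_mulVec_eq_single s hc
  have hAC : A * C = replicateCol (Fin 1) (Pi.single s (ρ : ℂ)) := by
    rw [← hAc, replicateCol_mulVec, ← hC]
  have hadd : M 0 0 + starRingEnd ℂ (M 0 0) = ρ * ρ := by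
    simpa [hAC, mul_apply, Pi.single_apply] using
      congrFun₂ (h.mul_left hA).add_conjTranspose 0 0
  obtain ⟨c, hc⟩ := Cavity.exists_neg_response_eq hρ hadd
  have hAC' (w : ℝ) : A * allPass M C w * Aᴴ = onMode s (-1) * onMode s (c.response w) := by
    rw [← allPass_mul_left hA, hAC, allPass_replicateCol_single, ← onMode_mul, neg_one_mul, hc]
    simp
  have hprod : allPass M C = (fun _ => Aᴴ) * ((fun _ => onMode s (-1)) * fun w =>
      onMode s (c.response w)) * fun _ => A := funext fun w => by
    have hAA : Aᴴ * A = 1 := mem_unitaryGroup_iff'.1 hA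
    calc allPass M C w = (Aᴴ * A) * allPass M C w * (Aᴴ * A) := by
          rw [hAA, Matrix.one_mul, Matrix.mul_one]
      _ = Aᴴ * (A * allPass M C w * Aᴴ) * A := by simp only [Matrix.mul_assoc]
      _ = Aᴴ * (onMode s (-1) * onMode s (c.response w)) * A := by rw [hAC']
  have hneg : onMode s (-1) ∈ unitaryGroup (Fin N) ℂ :=
    onMode_mem_unitaryGroup s (by simp [Unitary.mem_iff])
  rw [hprod]
  exact mul_mem (mul_mem (unitary_const_mem_realizable (Unitary.star_mem hA))
    (mul_mem (unitary_const_mem_realizable hneg) (onMode_cavity_mem_realizable s c)))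
    (unitary_const_mem_realizable hA)

theorem exists_unitary_conj_eq_fromBlocks {n : ℕ} (M : Matrix (Fin (n + 1)) (Fin (n + 1)) ℂ) :
    ∃ A : Matrix (Fin n ⊕ Fin 1) (Fin (n + 1)) ℂ, Aᴴ * A = 1 ∧ A * Aᴴ = 1 ∧
      ∃ M₁ K M₂, A * M * Aᴴ = fromBlocks M₁ 0 K M₂ := by
  obtain ⟨μ, hμ⟩ := Module.End.exists_eigenvalue (Matrix.toLin' M)
  obtain ⟨v, hv⟩ := hμ.exists_hasEigenvector
  have hMv : M *ᵥ v = μ • v := by simpa using hv.apply_eq_smul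
  obtain ⟨B, hB, ρ, hρ, hBv⟩ := exists_unitary_mulVec_eq_single (finSumFinEquiv (Sum.inr 0)) hv.2
  set A : Matrix (Fin n ⊕ Fin 1) (Fin (n + 1)) ℂ := B.submatrix finSumFinEquiv id with hA
  have hA1 : Aᴴ * A = 1 := by
    rw [hA, conjTranspose_submatrix, submatrix_mul_equiv, ← star_eq_conjTranspose,
      mem_unitaryGroup_iff'.1 hB, submatrix_id_id]
  have hA2 : A * Aᴴ = 1 := by
    rw [hA, conjTranspose_submatrix, ← submatrix_mul _ _ _ _ _ Function.bijective_id,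
      ← star_eq_conjTranspose, mem_unitaryGroup_iff.1 hB, submatrix_one_equiv]
  have hAv : A *ᵥ v = Pi.single (Sum.inr 0) (ρ : ℂ) := by
    change (B *ᵥ v) ∘ finSumFinEquiv = _
    rw [hBv]
    ext i
    simp only [Function.comp_apply, Pi.single_apply, EmbeddingLike.apply_eq_iff_eq]
  have heigen : (A * M * Aᴴ) *ᵥ Pi.single (Sum.inr 0) (ρ : ℂ) =
      μ • Pi.single (Sum.inr 0) (ρ : ℂ) := by
    rw [← hAv, mulVec_mulVec, Matrix.mul_assoc, hA1, Matrix.mul_one, ← mulVec_mulVec, hMv,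
      mulVec_smul]
  have hblock : (A * M * Aᴴ).toBlocks₁₂ = 0 := by
    ext i j
    have hij := congrFun heigen (Sum.inl i)
    rw [Subsingleton.elim j 0, toBlocks₁₂]
    simpa [mulVec_single, hρ.ne'] using hij
  exact ⟨A, hA1, hA2, _, _, _, hblock ▸ (fromBlocks_toBlocks (A * M * Aᴴ)).symm⟩

theorem IsLossless.allPass_mem_realizable {n : ℕ} {M : Matrix (Fin n) (Fin n) ℂ}
    {C : Matrix (Fin N) (Fin n) ℂ} (h : IsLossless M C) :
    allPass M C ∈ realizable N cavityPhases := by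
  induction n with
  | zero =>
    have h1 : allPass M C = 1 := funext fun w => by ext i j; simp [allPass]
    exact h1 ▸ one_mem _
  | succ n ih =>
    obtain ⟨A, hA, hA', M₁, K, M₂, hAM⟩ := exists_unitary_conj_eq_fromBlocks M
    have hL := h.change_states hA'
    rw [hAM, ← fromCols_toCols (C * Aᴴ)] at hL
    obtain ⟨h₁, -, h₂⟩ := hL.of_fromBlocks
    have hprod : allPass M C = allPass M₂ (C * Aᴴ).toCols₂ * allPass M₁ (C * Aᴴ).toCols₁ :=
      funext fun w => by
        rw [← h.allPass_change_states hA hA', hAM, ← fromCols_toCols (C * Aᴴ)]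
        exact hL.allPass_fromBlocks w
    exact hprod ▸ mul_mem h₂.allPass_mem_realizable_one (ih h₁)

end Realization

section PassiveSystem

variable {N : ℕ}

theorem PassiveSystem.isLossless (S : PassiveSystem N) :
    IsLossless (diagonal (fun m => (S.γ m : ℂ)) + Complex.I • S.G)
      (diagonal fun m => ((Real.sqrt (2 * S.γ m) : ℝ) : ℂ)) := by
  have hpos (m) : 0 < 2 * S.γ m := mul_pos two_pos (S.γ_pos m)
  refine ⟨?_, ?_⟩
  · rw [conjTranspose_add, conjTranspose_smul, S.G_herm.eq, diagonal_conjTranspose,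
      diagonal_conjTranspose, diagonal_mul_diagonal, add_add_add_comm, diagonal_add, ← add_smul]
    have hsqrt (m) : ((Real.sqrt (2 * S.γ m) : ℝ) : ℂ) * Real.sqrt (2 * S.γ m) = S.γ m + S.γ m := by
      rw [← Complex.ofReal_mul, Real.mul_self_sqrt (hpos m).le, two_mul, Complex.ofReal_add]
    simpa using fun m => (hsqrt m).symm
  · rw [mulVec_injective_iff_isUnit, isUnit_diagonal, Pi.isUnit_iff]
    exact fun m => (Complex.ofReal_ne_zero.2 (Real.sqrt_pos.2 (hpos m)).ne').isUnit

theorem PassiveSystem.transfer_mem_realizable (S : PassiveSystem N) :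
    S.transfer ∈ realizable N cavityPhases := by
  have hneg : (-1 : Matrix (Fin N) (Fin N) ℂ) ∈ unitaryGroup (Fin N) ℂ := by
    simp [mem_unitaryGroup_iff]
  have hS : S.transfer = (fun _ => -1) * allPass (diagonal (fun m => (S.γ m : ℂ)) + Complex.I • S.G)
      (diagonal fun m => ((Real.sqrt (2 * S.γ m) : ℝ) : ℂ)) := funext fun w => by
    have hD : star (fun m => ((Real.sqrt (2 * S.γ m) : ℝ) : ℂ)) =
        fun m => ((Real.sqrt (2 * S.γ m) : ℝ) : ℂ) := funext fun m => Complex.conj_ofReal _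
    rw [Pi.mul_apply, allPass, diagonal_conjTranspose, hD, neg_one_mul, neg_sub,
      PassiveSystem.transfer]
  rw [hS]
  exact mul_mem (unitary_const_mem_realizable hneg) S.isLossless.allPass_mem_realizable

theorem cascadeTransfer_mem_realizable (L : List (PassiveSystem N)) :
    cascadeTransfer L ∈ realizable N cavityPhases := by
  have h : cascadeTransfer L = (L.map PassiveSystem.transfer).prod := funext fun w => by
    rw [cascadeTransfer, Pi.list_prod_apply, List.map_map]
    rfl
  rw [h]
  refine list_prod_mem fun U hU => ?_
  obtain ⟨S, -, rfl⟩ := List.mem_map.1 hU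
  exact S.transfer_mem_realizable

end PassiveSystem

end FrequencyMesh

theorem proposition2_general (N : ℕ) :
    (∀ r : WithTop ℕ∞, 1 ≤ r →
      ∀ U : ℝ → Matrix (Fin N) (Fin N) ℂ,
        (∀ i j, ContDiff ℝ r fun w => U w i j) →
        (∀ w, U w ∈ Matrix.unitaryGroup (Fin N) ℂ) →
        ∃ M : FrequencyMesh.Mesh N (ℝ → ℝ),
          M.AllSingle (fun φ => ContDiff ℝ r φ) ∧
          (∀ w, M.transfer FrequencyMesh.shifterResponse w = U w) ∧
          M.AllSingle (fun φ => ∀ a b ε : ℝ, 0 < ε →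
            ∃ C D : List FrequencyMesh.Cavity, ∀ w ∈ Set.Icc a b,
              ‖FrequencyMesh.chainResponse C w -
                FrequencyMesh.chainResponse D w * FrequencyMesh.shifterResponse φ w‖ < ε) ∧
          ∀ a b ε : ℝ, 0 < ε →
            ∃ (D : List FrequencyMesh.Cavity)
              (M' : FrequencyMesh.Mesh N (List FrequencyMesh.Cavity)),
              ∀ w ∈ Set.Icc a b, ∀ i j,
                ‖M'.transfer FrequencyMesh.chainResponse w i j -
                  FrequencyMesh.chainResponse D w * U w i j‖ < ε) ∧
    (∀ L : List (FrequencyMesh.PassiveSystem N),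
      ∃ M : FrequencyMesh.Mesh N (ℝ → ℝ),
        M.AllSingle (fun φ => ContDiff ℝ ω φ) ∧
        (∀ w, M.transfer FrequencyMesh.shifterResponse w = FrequencyMesh.cascadeTransfer L w) ∧
        ∀ a b ε : ℝ, 0 < ε →
          ∃ M' : FrequencyMesh.Mesh N (List FrequencyMesh.Cavity),
            List.Forall₂ (FrequencyMesh.Replaces a b ε) M M' ∧
            ∀ w ∈ Set.Icc a b, ∀ i j,
              ‖M'.transfer FrequencyMesh.chainResponse w i j -
                FrequencyMesh.cascadeTransfer L w i j‖ < ε) := by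
  refine ⟨fun r hr U hU hu => ?_, fun L => ?_⟩
  · obtain ⟨M, hM, hMU⟩ := FrequencyMesh.mem_realizable_of_contDiff hr hU hu
    have hrel : ∀ a b, M.AllSingle (· ∈ FrequencyMesh.relApprox (Set.Icc a b)) :=
      fun a b m φ h => FrequencyMesh.mem_relApprox_of_continuous (hM m φ h).continuous a b
    refine ⟨M, hM, hMU, fun m φ h a b => hrel a b m φ h, fun a b ε hε => ?_⟩
    obtain ⟨D, M', hM'⟩ :=
      (FrequencyMesh.realizable_relApprox_le N _ ⟨M, hrel a b, hMU⟩).2 ε hε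
    exact ⟨D, M', fun w hw i j =>
      (FrequencyMesh.norm_apply_le_l2_opNorm _ i j).trans_lt (hM' w hw)⟩
  · obtain ⟨M, hM, hML⟩ := FrequencyMesh.cascadeTransfer_mem_realizable L
    refine ⟨M, fun m φ h => (hM m φ h).1, hML, fun a b ε hε => ?_⟩
    obtain ⟨M', hMM', hM'⟩ := FrequencyMesh.Mesh.exists_replaces
      (fun m φ h => (hM m φ h).2 a b) hε
    refine ⟨M', hMM', fun w hw i j => ?_⟩
    rw [← hML w]
    exact (FrequencyMesh.norm_apply_le_l2_opNorm _ i j).trans_lt (hM' w hw)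

theorem proposition2 (N : ℕ) :
    -- every smooth, or real-analytic, frequency-dependent unitary
    (∀ r : WithTop ℕ∞, (r = ∞ ∨ r = ω) →
      ∀ U : ℝ → Matrix (Fin N) (Fin N) ℂ,
        (∀ i j, ContDiff ℝ r fun w => U w i j) →
        (∀ w, U w ∈ Matrix.unitaryGroup (Fin N) ℂ) →
        ∃ M : FrequencyMesh.Mesh N (ℝ → ℝ),
          M.AllSingle (fun φ => ContDiff ℝ r φ) ∧
          (∀ w, M.transfer FrequencyMesh.shifterResponse w = U w) ∧
          M.AllSingle (fun φ => ∀ a b ε : ℝ, 0 < ε →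
            ∃ C D : List FrequencyMesh.Cavity, ∀ w ∈ Set.Icc a b,
              ‖FrequencyMesh.chainResponse C w -
                FrequencyMesh.chainResponse D w * FrequencyMesh.shifterResponse φ w‖ < ε) ∧
          ∀ a b ε : ℝ, 0 < ε →
            ∃ (D : List FrequencyMesh.Cavity)
              (M' : FrequencyMesh.Mesh N (List FrequencyMesh.Cavity)),
              ∀ w ∈ Set.Icc a b, ∀ i j,
                ‖M'.transfer FrequencyMesh.chainResponse w i j -
                  FrequencyMesh.chainResponse D w * U w i j‖ < ε) ∧
    -- every transfer function of a passive system, or of a cascade of such systems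
    (∀ L : List (FrequencyMesh.PassiveSystem N),
      ∃ M : FrequencyMesh.Mesh N (ℝ → ℝ),
        M.AllSingle (fun φ => ContDiff ℝ ω φ) ∧
        (∀ w, M.transfer FrequencyMesh.shifterResponse w = FrequencyMesh.cascadeTransfer L w) ∧
        ∀ a b ε : ℝ, 0 < ε →
          ∃ M' : FrequencyMesh.Mesh N (List FrequencyMesh.Cavity),
            List.Forall₂ (FrequencyMesh.Replaces a b ε) M M' ∧
            ∀ w ∈ Set.Icc a b, ∀ i j,
              ‖M'.transfer FrequencyMesh.chainResponse w i j -
                FrequencyMesh.cascadeTransfer L w i j‖ < ε) :=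
  have h := proposition2_general N
  ⟨fun r hr => h.1 r (by rcases hr with rfl | rfl <;> norm_cast), h.2⟩
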